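/- Let $n \ge 0$. A matching of $\{1,\dots,2n\}$ is a fixed point free involution $\pi \in S_{2n}$. For $\pi \in S_{2n}$ let $\mathrm{Des}(\pi)=\{\,1\le i\le 2n-1 : \pi(i)>\pi(i+1)\,\}$, $d(\pi)=|\mathrm{Des}(\pi)|+1$ and $\mathrm{maj}(\pi)=\sum_{i\in \mathrm{Des}(\pi)} i$. An oscillating tableau of empty shape and length $2n$ is a sequence $(\lambda_0,\dots,\lambda_{2n})$ of partitions (Young diagrams) with $\lambda_0=\lambda_{2n}=\emptyset$ in which $\lambda_i$ differs from $\lambda_{i-1}$ by a single box for $1\le i\le 2n$; its conjugate is $(\lambda_0',\dots,\lambda_{2n}')$. For a matching $\pi$ define Young tableaux $P_0,\dots,P_{2n}$ as follows. $P_0=\emptyset$. If $i$ is the smaller element of its block $\{i,j\}$ in $\pi$, then $P_i$ is obtained from $P_{i-1}$ by row-inserting $j$. If $i$ is the larger element of its block, then $P_i$ is obtained from $P_{i-1}$ by removing the entry $i$ and sliding the hole out (repeatedly, the smaller of the entries to the right of and below the hole moves into it). Let $T(\pi)=(\mathrm{sh}(P_0),\dots,\mathrm{sh}(P_{2n}))$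 be the sequence of shapes. Then $T$ is a bijection from the matchings of $\{1,\dots,2n\}$ to the oscillating tableaux of empty shape and length $2n$ (Sundaram). For every matching $\pi$, the matching $\pi'=T^{-1}(T(\pi)')$, where $T(\pi)'$ is the conjugate oscillating tableau, satisfies $$d(\pi)+d(\pi')=2(n+1) \qquad\text{and}\qquad \mathrm{maj}(\pi)+\mathrm{maj}(\pi')=2n^2 .$$ Consequently both statistics are symmetrically distributed on matchings: if $a+b=2(n+1)$ then as many matchings have $d=a$ as have $d=b$, and if $a+b=2n^2$ then as many matchings have $\mathrm{maj}=a$ as have $\mathrm{maj}=b$. -/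

import Mathlib

namespace Sundaram

/-! ### Permutation statistics

The element `a` of `Fin m` plays the role of the letter `a + 1` of `{1, …, m}`. -/

/-- The descent set of `σ`: the positions `i ∈ {1, …, m - 1}` with `σ(i) > σ(i + 1)`. -/
def descentSet {m : ℕ} (σ : Equiv.Perm (Fin m)) : Finset ℕ :=
  ({a : Fin m | ∃ h : a.val + 1 < m, σ ⟨a.val + 1, h⟩ < σ a} : Finset (Fin m)).image
    fun a => a.val + 1

/-- The descent number `d(σ) = |Des(σ)| + 1`. -/
def descentNumber {m : ℕ} (σ : Equiv.Perm (Fin m)) : ℕ :=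
  (descentSet σ).card + 1

/-- The major index, the sum of the descent positions. -/
def majorIndex {m : ℕ} (σ : Equiv.Perm (Fin m)) : ℕ :=
  ∑ i ∈ descentSet σ, i

/-- Matchings of `{1, …, 2n}`: fixed point free involutions. -/
abbrev Matching (n : ℕ) : Type :=
  {π : Equiv.Perm (Fin (2 * n)) // π ^ 2 = 1 ∧ ∀ i, π i ≠ i}

/-! ### Oscillating tableaux -/

/-- `ν` is obtained from `μ` by adding a single box. -/
def AddsBox (μ ν : YoungDiagram) : Prop :=
  μ ≤ ν ∧ ν.card = μ.card + 1

/-- Oscillating tableaux of length `m` and shape `lam`. -/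
@[ext]
structure OscillatingTableau (m : ℕ) (lam : YoungDiagram) where
  diagram : Fin (m + 1) → YoungDiagram
  first : diagram 0 = ⊥
  last : diagram (Fin.last m) = lam
  step : ∀ i : Fin m, AddsBox (diagram i.castSucc) (diagram i.succ) ∨
    AddsBox (diagram i.succ) (diagram i.castSucc)

theorem AddsBox.transpose {μ ν : YoungDiagram} (h : AddsBox μ ν) :
    AddsBox μ.transpose ν.transpose := by
  have key : ∀ μ : YoungDiagram, μ.transpose.card = μ.card := fun μ => by
    simp [YoungDiagram.card, YoungDiagram.transpose]
  exact ⟨YoungDiagram.transpose_mono h.1, by rw [key, key, h.2]⟩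

theorem transpose_bot : (⊥ : YoungDiagram).transpose = ⊥ := by
  ext c
  simp

/-- The conjugate oscillating tableau: every diagram is replaced by its conjugate. -/
def OscillatingTableau.conj {m : ℕ} {lam : YoungDiagram} (t : OscillatingTableau m lam) :
    OscillatingTableau m lam.transpose where
  diagram i := (t.diagram i).transpose
  first := by rw [t.first, transpose_bot]
  last := by rw [t.last]
  step i := (t.step i).imp AddsBox.transpose AddsBox.transpose

/-- The conjugate of an oscillating tableau of empty shape, again of empty shape. -/
def OscillatingTableau.conjEmpty {m : ℕ} (t : OscillatingTableau m ⊥) :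
    OscillatingTableau m ⊥ where
  __ := t.conj
  last := t.conj.last.trans transpose_bot

/-! ### Young tableaux, row insertion and sliding -/

/-- A Young tableau of arbitrary shape; `P.1` is the shape of `P`. -/
abbrev Tableau : Type :=
  Σ μ : YoungDiagram, SemistandardYoungTableau μ

/-- The entry of `P` in row `r` and column `c` (counted from `0`), and `⊤` where `P` has no box. -/
def Tableau.box (P : Tableau) (r c : ℕ) : WithTop ℕ :=
  if (r, c) ∈ P.1 then ((P.2 r c : ℕ) : WithTop ℕ) else ⊤

/-- The functions of the form `P.box`. -/
structure IsFilling (F : ℕ → ℕ → WithTop ℕ) : Prop where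
  row : ∀ r c, F r c ≤ F r (c + 1)
  col : ∀ r c, F (r + 1) c ≠ ⊤ → F r c < F (r + 1) c
  finite : {p : ℕ × ℕ | F p.1 p.2 ≠ ⊤}.Finite

theorem Tableau.isFilling_box (P : Tableau) : IsFilling P.box where
  row r c := by
    unfold Tableau.box
    by_cases h : (r, c + 1) ∈ P.1
    · rw [if_pos h, if_pos (P.1.up_left_mem le_rfl (Nat.le_succ c) h)]
      exact_mod_cast P.2.row_weak (Nat.lt_succ_self c) h
    · rw [if_neg h]; exact le_top
  col r c h := by
    unfold Tableau.box at h ⊢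
    have h' : (r + 1, c) ∈ P.1 := by
      by_contra hc
      exact h (if_neg hc)
    rw [if_pos h', if_pos (P.1.up_left_mem (Nat.le_succ r) le_rfl h')]
    exact_mod_cast P.2.col_strict (Nat.lt_succ_self r) h'
  finite := by
    refine P.1.cells.finite_toSet.subset ?_
    rintro ⟨r, c⟩ h
    by_contra hc
    exact h (if_neg hc)

theorem IsFilling.monotone_row {F : ℕ → ℕ → WithTop ℕ} (hF : IsFilling F) (r : ℕ) :
    Monotone (F r) :=
  monotone_nat_of_le_succ (hF.row r)

theorem IsFilling.le_succ {F : ℕ → ℕ → WithTop ℕ} (hF : IsFilling F) (r c : ℕ) :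
    F r c ≤ F (r + 1) c := by
  by_cases h : F (r + 1) c = ⊤
  · rw [h]; exact le_top
  · exact (hF.col r c h).le

theorem IsFilling.monotone_col {F : ℕ → ℕ → WithTop ℕ} (hF : IsFilling F) (c : ℕ) :
    Monotone fun r => F r c :=
  monotone_nat_of_le_succ fun r => hF.le_succ r c

theorem IsFilling.lt_of_lt {F : ℕ → ℕ → WithTop ℕ} (hF : IsFilling F) {r s c : ℕ}
    (hrs : r < s) (h : F s c ≠ ⊤) : F r c < F s c := by
  have h1 : F (r + 1) c ≤ F s c := hF.monotone_col c (Nat.succ_le_of_lt hrs)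
  exact (hF.col r c (ne_top_of_le_ne_top h h1)).trans_le h1

/-- The tableau with the entries `F`; its boxes are the places where `F` is not `⊤`. -/
noncomputable def Tableau.ofFilling (F : ℕ → ℕ → WithTop ℕ) (hF : IsFilling F) : Tableau :=
  ⟨{ cells := hF.finite.toFinset
     isLowerSet := by
      rintro ⟨r, c⟩ ⟨s, d⟩ ⟨h1, h2⟩ h
      simp only [Set.Finite.coe_toFinset, Set.mem_ofPred_eq] at h ⊢
      exact ne_top_of_le_ne_top h ((hF.monotone_row s h2).trans (hF.monotone_col c h1)) },
   { entry := fun r c => (F r c).untopD 0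
     row_weak' := by
      intro r c d hcd h
      have h' : F r d ≠ ⊤ := by simpa [← YoungDiagram.mem_cells] using h
      have hle : F r c ≤ F r d := hF.monotone_row r hcd.le
      lift F r d to ℕ using h' with y
      lift F r c to ℕ using ne_top_of_le_ne_top (WithTop.coe_ne_top) hle with x
      exact_mod_cast hle
     col_strict' := by
      intro r s c hrs h
      have h' : F s c ≠ ⊤ := by simpa [← YoungDiagram.mem_cells] using h
      have hlt : F r c < F s c := hF.lt_of_lt hrs h'
      lift F s c to ℕ using h' with y
      lift F r c to ℕ using hlt.ne_top with x
      exact_mod_cast hlt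
     zeros' := by
      intro r c h
      have h' : F r c = ⊤ := by simpa [← YoungDiagram.mem_cells] using h
      simp [h'] }⟩

theorem Tableau.box_ofFilling (F : ℕ → ℕ → WithTop ℕ) (hF : IsFilling F) :
    (Tableau.ofFilling F hF).box = F := by
  funext r c
  have hmem : (r, c) ∈ (Tableau.ofFilling F hF).1 ↔ F r c ≠ ⊤ := by
    simp [Tableau.ofFilling, ← YoungDiagram.mem_cells]
  unfold Tableau.box
  by_cases h : F r c = ⊤
  · rw [if_neg (by simp [hmem, h]), h]
  · rw [if_pos (hmem.2 h)]
    change (((F r c).untopD 0 : ℕ) : WithTop ℕ) = F r c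
    lift F r c to ℕ using h with x
    rfl

/-- The column in which row `r` receives `x`: the left-most place whose entry is strictly larger
than `x`, or the first place after the end of the row (where `F` is `⊤`) if there is none. -/
noncomputable def bumpColumn (F : ℕ → ℕ → WithTop ℕ) (r : ℕ) (x : WithTop ℕ) : ℕ :=
  sInf {c | x < F r c}

/-- The letter that the row insertion of `x` into `F` puts into row `r`: it is `x` for `r = 0` and
the entry bumped from row `r - 1` for `r > 0`. The value `⊤` means that the insertion has ended
before row `r`. -/
noncomputable def carried (F : ℕ → ℕ → WithTop ℕ) (x : ℕ) : ℕ → WithTop ℕ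
  | 0 => x
  | r + 1 => if carried F x r = ⊤ then ⊤ else F r (bumpColumn F r (carried F x r))

/-- The result of the row insertion of `x` into `F`. -/
noncomputable def insertFilling (F : ℕ → ℕ → WithTop ℕ) (x : ℕ) (r c : ℕ) : WithTop ℕ :=
  if carried F x r ≠ ⊤ ∧ c = bumpColumn F r (carried F x r) then carried F x r else F r c

theorem IsFilling.exists_top {F : ℕ → ℕ → WithTop ℕ} (hF : IsFilling F) (r : ℕ) :
    ∃ c, F r c = ⊤ := by
  by_contra! h
  exact Set.infinite_of_injective_forall_mem (f := fun c : ℕ => (r, c))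
    (fun a b hab => (Prod.mk.inj hab).2) (fun c => h c) hF.finite

theorem IsFilling.lt_bumpColumn {F : ℕ → ℕ → WithTop ℕ} (hF : IsFilling F) (r : ℕ)
    {x : WithTop ℕ} (hx : x ≠ ⊤) : x < F r (bumpColumn F r x) := by
  obtain ⟨c, hc⟩ := hF.exists_top r
  exact Nat.sInf_mem (s := {c | x < F r c}) ⟨c, by simpa [hc] using hx.lt_top⟩

theorem le_of_lt_bumpColumn {F : ℕ → ℕ → WithTop ℕ} {r c : ℕ} {x : WithTop ℕ}
    (h : c < bumpColumn F r x) : F r c ≤ x :=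
  not_lt.1 (Nat.notMem_of_lt_sInf h)

theorem bumpColumn_le {F : ℕ → ℕ → WithTop ℕ} {r c : ℕ} {x : WithTop ℕ}
    (h : x < F r c) : bumpColumn F r x ≤ c :=
  Nat.sInf_le h

theorem carried_succ {F : ℕ → ℕ → WithTop ℕ} {x r : ℕ} (h : carried F x r ≠ ⊤) :
    carried F x (r + 1) = F r (bumpColumn F r (carried F x r)) := by
  rw [carried, if_neg h]

theorem carried_ne_top_of_succ {F : ℕ → ℕ → WithTop ℕ} {x r : ℕ}
    (h : carried F x (r + 1) ≠ ⊤) : carried F x r ≠ ⊤ := by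
  intro h'
  exact h (by rw [carried, if_pos h'])

theorem IsFilling.insert {F : ℕ → ℕ → WithTop ℕ} (hF : IsFilling F) (x : ℕ) :
    IsFilling (insertFilling F x) where
  row r c := by
    unfold insertFilling
    by_cases ht : carried F x r = ⊤
    · simpa [ht] using hF.row r c
    · have hlt := hF.lt_bumpColumn r ht
      set k := bumpColumn F r (carried F x r) with hk
      simp only [ne_eq, ht, not_false_eq_true, true_and]
      split_ifs with h1 h2 h2
      · omega
      · exact hlt.le.trans (hF.monotone_row r (by omega))
      · exact le_of_lt_bumpColumn (by omega)
      · exact hF.row r c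
  col r c := by
    unfold insertFilling
    intro hne
    by_cases h1 : carried F x (r + 1) ≠ ⊤ ∧ c = bumpColumn F (r + 1) (carried F x (r + 1))
    · rw [if_pos h1]
      have ht := carried_ne_top_of_succ h1.1
      have hs := carried_succ ht
      have hlt := hF.lt_bumpColumn r ht
      by_cases h2 : c = bumpColumn F r (carried F x r)
      · rw [if_pos ⟨ht, h2⟩, hs]; exact hlt
      · rw [if_neg fun h => h2 h.2]
        have hle : c ≤ bumpColumn F r (carried F x r) := by
          rw [h1.2]
          refine bumpColumn_le ?_
          by_cases h3 : F (r + 1) (bumpColumn F r (carried F x r)) = ⊤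
          · rw [h3]; exact h1.1.lt_top
          · rw [hs]; exact hF.col _ _ h3
        rw [hs]
        exact (le_of_lt_bumpColumn (lt_of_le_of_ne hle h2)).trans_lt hlt
    · rw [if_neg h1] at hne ⊢
      have hcol := hF.col r c hne
      split_ifs with h2
      · have hlt := hF.lt_bumpColumn r h2.1
        rw [← h2.2] at hlt
        exact hlt.trans hcol
      · exact hcol
  finite := by
    obtain ⟨R, hR⟩ : ∃ R, ∀ r, R ≤ r → carried F x r = ⊤ := by
      have hex : ∃ R, F R 0 = ⊤ := by
        by_contra! h
        exact Set.infinite_of_injective_forall_mem (f := fun r : ℕ => (r, 0))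
          (fun a b hab => (Prod.mk.inj hab).1) (fun r => h r) hF.finite
      obtain ⟨R, hR⟩ := hex
      have h0 : carried F x (R + 1) = ⊤ := by
        by_contra hne
        rw [carried_succ (carried_ne_top_of_succ hne)] at hne
        exact hne (top_le_iff.1 (hR ▸ hF.monotone_row R (Nat.zero_le _)))
      refine ⟨R + 1, fun r hr => ?_⟩
      induction r, hr using Nat.le_induction with
      | base => exact h0
      | succ r _ ih => rw [carried, if_pos ih]
    refine (hF.finite.union ((Set.finite_Iio R).image
      fun r => (r, bumpColumn F r (carried F x r)))).subset ?_
    rintro ⟨r, c⟩ h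
    by_cases h1 : carried F x r ≠ ⊤ ∧ c = bumpColumn F r (carried F x r)
    · refine Or.inr ⟨r, ?_, by rw [h1.2]⟩
      by_contra hr
      exact h1.1 (hR r (not_lt.1 hr))
    · refine Or.inl ?_
      simpa only [Set.mem_ofPred_eq, insertFilling, if_neg h1] using h

/-- Row insertion `P ← x`. -/
noncomputable def Tableau.rowInsert (P : Tableau) (x : ℕ) : Tableau :=
  Tableau.ofFilling (insertFilling P.box x) (P.isFilling_box.insert x)

/-- The places visited by the hole that starts at `p`: the smaller of the box to the right and the
box below, the one below in case of a tie, slides into the hole. (When the hole has reached an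
outside corner, both neighbours are `⊤`; its further way downwards stays outside the diagram and
changes nothing.) -/
def holePath (F : ℕ → ℕ → WithTop ℕ) (p : ℕ × ℕ) : ℕ → ℕ × ℕ
  | 0 => p
  | k + 1 =>
    let q := holePath F p k
    if F (q.1 + 1) q.2 ≤ F q.1 (q.2 + 1) then (q.1 + 1, q.2) else (q.1, q.2 + 1)

open Classical in
/-- The result of removing the entry of `F` at `p` and sliding the hole out: every place visited by
the hole receives the entry that slides into it. -/
noncomputable def slideFilling (F : ℕ → ℕ → WithTop ℕ) (p : ℕ × ℕ) (r c : ℕ) : WithTop ℕ :=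
  if ∃ k, holePath F p k = (r, c) then min (F (r + 1) c) (F r (c + 1)) else F r c

theorem IsFilling.le_slide {F : ℕ → ℕ → WithTop ℕ} (hF : IsFilling F) (p : ℕ × ℕ) (r c : ℕ) :
    F r c ≤ slideFilling F p r c := by
  unfold slideFilling
  split_ifs
  · exact le_min (hF.le_succ r c) (hF.row r c)
  · exact le_rfl

theorem IsFilling.slide {F : ℕ → ℕ → WithTop ℕ} (hF : IsFilling F) (p : ℕ × ℕ) :
    IsFilling (slideFilling F p) where
  row r c := by
    refine le_trans ?_ (hF.le_slide p r (c + 1))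
    unfold slideFilling
    split_ifs
    · exact min_le_right _ _
    · exact hF.row r c
  col r c hne := by
    by_cases h : ∃ k, holePath F p k = (r, c)
    · have h1 : slideFilling F p r c = min (F (r + 1) c) (F r (c + 1)) := if_pos h
      obtain ⟨k, hk⟩ := h
      by_cases hd : F (r + 1) c ≤ F r (c + 1)
      · have h2 : slideFilling F p (r + 1) c
            = min (F (r + 1 + 1) c) (F (r + 1) (c + 1)) := by
          refine if_pos ⟨k + 1, ?_⟩
          simp only [holePath, hk]
          rw [if_pos hd]
        rw [h1]
        rw [h2] at hne ⊢
        have h3 : F (r + 1) c ≠ ⊤ := by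
          intro h4
          apply hne
          rw [min_eq_top]
          constructor
          · exact top_le_iff.1 (h4 ▸ hF.le_succ (r + 1) c)
          · exact top_le_iff.1 (h4 ▸ hF.row (r + 1) c)
        refine lt_min ?_ ?_
        · refine (min_le_left _ _).trans_lt ?_
          by_cases h4 : F (r + 1 + 1) c = ⊤
          · rw [h4]; exact h3.lt_top
          · exact hF.col _ _ h4
        · by_cases h4 : F (r + 1) (c + 1) = ⊤
          · rw [h4]; exact (min_le_left _ _).trans_lt h3.lt_top
          · exact (min_le_right _ _).trans_lt (hF.col _ _ h4)
      · rw [h1]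
        exact ((min_le_right _ _).trans_lt (not_le.1 hd)).trans_le (hF.le_slide p _ _)
    · have h1 : slideFilling F p r c = F r c := if_neg h
      rw [h1]
      by_cases h2 : F (r + 1) c = ⊤
      · exact absurd (top_le_iff.1 (h2 ▸ hF.le_slide p (r + 1) c)) hne
      · exact (hF.col r c h2).trans_le (hF.le_slide p (r + 1) c)
  finite := by
    refine hF.finite.subset ?_
    rintro ⟨r, c⟩ h
    exact fun h' => h (top_le_iff.1 (h' ▸ hF.le_slide p r c))

open Classical in
/-- Remove the entry `x` from `P` and slide the hole out (`P` itself if `x` is not in `P`). -/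
noncomputable def Tableau.removeEntry (P : Tableau) (x : ℕ) : Tableau :=
  if h : ∃ p : ℕ × ℕ, P.box p.1 p.2 = x then
    Tableau.ofFilling (slideFilling P.box h.choose) (P.isFilling_box.slide h.choose)
  else P

/-- The empty tableau. -/
def Tableau.empty : Tableau :=
  ⟨⊥, SemistandardYoungTableau.highestWeight ⊥⟩

/-! ### The map from matchings to sequences of shapes -/

/-- The tableaux `P_0, P_1, …, P_{2n}` of a matching: `P_0` is empty; if the letter `i` is the
smaller element of its block `{i, j}`, then `j` is row-inserted into `P_{i-1}`; if it is the larger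
one, then `i` is removed from `P_{i-1}` and the hole is slid out. The step from `P_a` to `P_{a+1}`
treats the letter `i = a + 1`, which is the element `a` of `Fin (2 * n)`. -/
noncomputable def tableauSeq {n : ℕ} (π : Matching n) : ℕ → Tableau
  | 0 => Tableau.empty
  | a + 1 =>
    if h : a < 2 * n then
      if a < (π.1 ⟨a, h⟩).val then (tableauSeq π a).rowInsert ((π.1 ⟨a, h⟩).val + 1)
      else (tableauSeq π a).removeEntry (a + 1)
    else tableauSeq π a

/-- `T(π)`, the sequence of the shapes of `P_0, …, P_{2n}`. -/
noncomputable def shapeSeq {n : ℕ} (π : Matching n) (i : Fin (2 * n + 1)) : YoungDiagram :=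
  (tableauSeq π i).1

end Sundaram

/-! Call a letter opening or closing according to whether it is the smaller or the larger element of
its block, that is, whether the shape grows or shrinks at its step. Conjugating the shapes preserves
this type. Compare two consecutive letters. Opening followed by closing is always a descent, closing
followed by opening never. If both have the same type, their steps form a chain of three diagrams,
read backwards for closing letters, and there is a descent exactly when the box added second in the
chain lies strictly below the one added first. Transposition negates this condition
(`descentChain_transpose`), so exactly one of $\pi,\pi'$ has the descent.

Hence in every case $\pi$ and $\pi'$ together have $1+f(i)-f(i+1)$ descents at $i$, where $f$ is the
indicator of the opening letters (`descent_add_descent`). Since $f$ is 1 at the first letter, 0 at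
the last and has sum $n$ (for $n>0$), the plain sum telescopes to $2n$, and the sum with weights $i$
is $n(2n-1)+n=2n^2$ by Abel summation.

For two opening letters the descent criterion is the row bumping lemma. For two closing letters
$x,x+1$ (`descent_iff_of_close_close`) the order in which they were inserted decides whether $x+1$
lies strictly below $x$ or weakly above. Insertions and slides preserve this position until $x$ is
to be removed from the corner. There it decides whether the hole of $x$ starts downwards or to the
right, and the hole of $x+1$ then stays on one side of the first path, which orders the two removed
boxes.

Bijectivity comes from running the construction backwards from the empty final tableau. The letters
of $P_a$ are all larger than $a$, so a removed letter is the minimum and sits in the corner. The two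
shapes then determine the reverse step, either a reverse row insertion or a reverse slide into the
corner. -/

namespace Sundaram

/-! ### Fillings with distinct entries -/

/-- All finite entries of `F` are distinct. -/
def EntriesDistinct (F : ℕ → ℕ → WithTop ℕ) : Prop :=
  ∀ r c s d, F r c = F s d → F r c ≠ ⊤ → r = s ∧ c = d

/-- The letter `v` occurs in `F`. -/
def HasEntry (F : ℕ → ℕ → WithTop ℕ) (v : ℕ) : Prop :=
  ∃ r c, F r c = (v : WithTop ℕ)

theorem exists_natCast_eq {a : WithTop ℕ} (h : a ≠ ⊤) : ∃ n : ℕ, (n : WithTop ℕ) = a :=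
  WithTop.ne_top_iff_exists.1 h

theorem IsFilling.mono {F : ℕ → ℕ → WithTop ℕ} (hF : IsFilling F) {r s c d : ℕ}
    (h1 : r ≤ s) (h2 : c ≤ d) : F r c ≤ F s d :=
  (hF.monotone_row r h2).trans (hF.monotone_col d h1)

theorem IsFilling.tail {F : ℕ → ℕ → WithTop ℕ} (hF : IsFilling F) :
    IsFilling fun r => F (r + 1) where
  row r := hF.row (r + 1)
  col r := hF.col (r + 1)
  finite := by
    refine Set.Finite.of_finite_image (f := fun p : ℕ × ℕ => (p.1 + 1, p.2))
      (hF.finite.subset ?_) ?_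
    · rintro _ ⟨p, hp, rfl⟩
      exact hp
    · rintro ⟨a, b⟩ - ⟨c, d⟩ - h
      simpa using h

theorem IsFilling.exists_row_top {F : ℕ → ℕ → WithTop ℕ} (hF : IsFilling F) :
    ∃ r, F r 0 = ⊤ := by
  by_contra! h
  exact Set.infinite_of_injective_forall_mem (f := fun r : ℕ => (r, 0))
    (fun a b hab => (Prod.mk.inj hab).1) (fun r => h r) hF.finite

/-! ### Row insertion -/

theorem carried_lt_succ {F : ℕ → ℕ → WithTop ℕ} (hF : IsFilling F) {x r : ℕ}
    (h : carried F x r ≠ ⊤) : carried F x r < carried F x (r + 1) := by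
  rw [carried_succ h]
  exact hF.lt_bumpColumn r h

theorem carried_monotone {F : ℕ → ℕ → WithTop ℕ} (hF : IsFilling F) (x : ℕ) :
    Monotone (carried F x) := by
  refine monotone_nat_of_le_succ fun r => ?_
  by_cases h : carried F x r = ⊤
  · rw [carried, if_pos h]
    exact le_top
  · exact (carried_lt_succ hF h).le

theorem carried_lt_of_lt {F : ℕ → ℕ → WithTop ℕ} (hF : IsFilling F) {x r s : ℕ} (hrs : r < s)
    (h : carried F x r ≠ ⊤) : carried F x r < carried F x s :=
  (carried_lt_succ hF h).trans_le (carried_monotone hF x hrs)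

theorem insertFilling_bump {F : ℕ → ℕ → WithTop ℕ} {x r : ℕ} (h : carried F x r ≠ ⊤) :
    insertFilling F x r (bumpColumn F r (carried F x r)) = carried F x r :=
  if_pos ⟨h, rfl⟩

theorem insertFilling_of_not {F : ℕ → ℕ → WithTop ℕ} {x r c : ℕ}
    (h : ¬ (carried F x r ≠ ⊤ ∧ c = bumpColumn F r (carried F x r))) :
    insertFilling F x r c = F r c :=
  if_neg h

theorem carried_eq_entry {F : ℕ → ℕ → WithTop ℕ} {x r : ℕ} (h : carried F x r ≠ ⊤) :
    (r = 0 ∧ carried F x r = x) ∨ ∃ s, r = s + 1 ∧ carried F x s ≠ ⊤ ∧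
      carried F x r = F s (bumpColumn F s (carried F x s)) := by
  cases r with
  | zero => exact Or.inl ⟨rfl, rfl⟩
  | succ s =>
    have hs := carried_ne_top_of_succ h
    exact Or.inr ⟨s, rfl, hs, carried_succ hs⟩

/-- During an insertion an entry stays in its place or moves to the next row. -/
theorem insertFilling_entry {F : ℕ → ℕ → WithTop ℕ} {x r c v : ℕ} (h : F r c = v) :
    insertFilling F x r c = v ∨
      carried F x (r + 1) = v ∧ ∃ d, insertFilling F x (r + 1) d = v := by
  by_cases h1 : carried F x r ≠ ⊤ ∧ c = bumpColumn F r (carried F x r)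
  · right
    have h2 : carried F x (r + 1) = v := by rw [carried_succ h1.1, ← h1.2, h]
    refine ⟨h2, bumpColumn F (r + 1) (carried F x (r + 1)), ?_⟩
    rw [insertFilling_bump (by simp [h2]), h2]
  · left
    rw [insertFilling_of_not h1, h]

theorem hasEntry_insertFilling {F : ℕ → ℕ → WithTop ℕ} {x v : ℕ} :
    HasEntry (insertFilling F x) v ↔ v = x ∨ HasEntry F v := by
  constructor
  · rintro ⟨r, c, h⟩
    by_cases h1 : carried F x r ≠ ⊤ ∧ c = bumpColumn F r (carried F x r)
    · rw [h1.2, insertFilling_bump h1.1] at h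
      rcases carried_eq_entry h1.1 with ⟨-, h2⟩ | ⟨s, -, -, h2⟩
      · left
        rw [h] at h2
        exact_mod_cast h2
      · exact Or.inr ⟨_, _, h2.symm.trans h⟩
    · rw [insertFilling_of_not h1] at h
      exact Or.inr ⟨r, c, h⟩
  · rintro (rfl | ⟨r, c, h⟩)
    · exact ⟨0, _, insertFilling_bump (by simp [carried])⟩
    · rcases insertFilling_entry (x := x) h with h1 | ⟨-, d, h1⟩
      · exact ⟨_, _, h1⟩
      · exact ⟨_, _, h1⟩

theorem EntriesDistinct.insert {F : ℕ → ℕ → WithTop ℕ} (hF : IsFilling F)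
    (hd : EntriesDistinct F) {x : ℕ} (hx : ¬ HasEntry F x) :
    EntriesDistinct (insertFilling F x) := by
  -- A carried letter is either the new letter or the former occupant of an overwritten place, so it
  -- cannot also survive elsewhere.
  have mixed : ∀ r c s d, carried F x r ≠ ⊤ → c = bumpColumn F r (carried F x r) →
      ¬ (carried F x s ≠ ⊤ ∧ d = bumpColumn F s (carried F x s)) →
      carried F x r ≠ F s d := by
    intro r c s d h1 h2 h3 h4
    rcases carried_eq_entry h1 with ⟨-, h5⟩ | ⟨t, -, h5, h6⟩
    · exact hx ⟨s, d, h4.symm.trans h5⟩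
    · obtain ⟨rfl, rfl⟩ := hd _ _ _ _ (h6.symm.trans h4) (h6 ▸ h1)
      exact h3 ⟨h5, rfl⟩
  intro r c s d h hne
  by_cases h1 : carried F x r ≠ ⊤ ∧ c = bumpColumn F r (carried F x r) <;>
    by_cases h2 : carried F x s ≠ ⊤ ∧ d = bumpColumn F s (carried F x s)
  · have h3 : r = s := by
      rw [h1.2, h2.2, insertFilling_bump h1.1, insertFilling_bump h2.1] at h
      rcases lt_trichotomy r s with h3 | h3 | h3
      · exact absurd h (carried_lt_of_lt hF h3 h1.1).ne
      · exact h3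
      · exact absurd h (carried_lt_of_lt hF h3 h2.1).ne'
    subst h3
    exact ⟨rfl, h1.2.trans h2.2.symm⟩
  · rw [insertFilling_of_not h2, h1.2, insertFilling_bump h1.1] at h
    exact absurd h (mixed r c s d h1.1 h1.2 h2)
  · rw [insertFilling_of_not h1, h2.2, insertFilling_bump h2.1] at h
    exact absurd h.symm (mixed s d r c h2.1 h2.2 h1)
  · rw [insertFilling_of_not h1] at h hne
    rw [insertFilling_of_not h2] at h
    exact hd _ _ _ _ h hne

/-- A row insertion ends in some row `R`, to which it adds a box. -/
theorem IsFilling.exists_lastRow {F : ℕ → ℕ → WithTop ℕ} (hF : IsFilling F) (x : ℕ) :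
    ∃ R k, (∀ r, carried F x r ≠ ⊤ ↔ r ≤ R) ∧ F R k = ⊤ ∧
      ∀ r c, insertFilling F x r c ≠ ⊤ ↔ F r c ≠ ⊤ ∨ (r = R ∧ c = k) := by
  have hex : ∃ r, carried F x r = ⊤ := by
    obtain ⟨r, hr⟩ := hF.exists_row_top
    refine ⟨r + 1, ?_⟩
    by_contra hne
    rw [carried_succ (carried_ne_top_of_succ hne)] at hne
    exact hne (top_le_iff.1 (hr ▸ hF.monotone_row r (Nat.zero_le _)))
  classical
  obtain ⟨R, hR⟩ : ∃ R, Nat.find hex = R + 1 :=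
    Nat.exists_eq_succ_of_ne_zero fun h => by
      have := Nat.find_spec hex
      rw [h] at this
      simp [carried] at this
  have h1 : ∀ r, carried F x r ≠ ⊤ ↔ r ≤ R := by
    intro r
    constructor
    · intro h
      by_contra hr
      have h2 : carried F x (R + 1) = ⊤ := hR ▸ Nat.find_spec hex
      exact h (top_le_iff.1 (h2 ▸ carried_monotone hF x (by omega)))
    · intro h
      exact Nat.find_min hex (by omega)
  have hRne := (h1 R).2 le_rfl
  have hRtop : F R (bumpColumn F R (carried F x R)) = ⊤ := by
    rw [← carried_succ hRne]
    by_contra h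
    have := (h1 (R + 1)).1 h
    omega
  refine ⟨R, bumpColumn F R (carried F x R), h1, hRtop, fun r c => ?_⟩
  by_cases h2 : carried F x r ≠ ⊤ ∧ c = bumpColumn F r (carried F x r)
  · rw [h2.2, insertFilling_bump h2.1]
    refine ⟨fun _ => ?_, fun _ => h2.1⟩
    rcases ((h1 r).1 h2.1).lt_or_eq with h3 | rfl
    · left
      rw [← carried_succ h2.1]
      exact (h1 (r + 1)).2 h3
    · exact Or.inr ⟨rfl, rfl⟩
  · rw [insertFilling_of_not h2]
    refine ⟨Or.inl, ?_⟩
    rintro (h3 | ⟨rfl, rfl⟩)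
    · exact h3
    · exact absurd ⟨hRne, rfl⟩ h2

/-- The first half of the row bumping lemma. -/
theorem carried_le_carried_insert {F : ℕ → ℕ → WithTop ℕ} (hF : IsFilling F) {x y : ℕ}
    (hxy : x ≤ y) (r : ℕ) : carried F x r ≤ carried (insertFilling F x) y r := by
  induction r with
  | zero => simpa [carried] using hxy
  | succ r ih =>
    by_cases h1 : carried (insertFilling F x) y r = ⊤
    · rw [carried.eq_2 (insertFilling F x), if_pos h1]
      exact le_top
    have h2 : carried F x r ≠ ⊤ := ne_top_of_le_ne_top h1 ih
    rw [carried_succ h1, carried_succ h2]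
    have h3 := (hF.insert x).lt_bumpColumn r h1
    -- The first insertion left its letter at its bump column. The second letter is at least as
    -- large, so it lands strictly to the right, where the row is unchanged.
    have h4 : bumpColumn F r (carried F x r) <
        bumpColumn (insertFilling F x) r (carried (insertFilling F x) y r) := by
      by_contra h
      have := (hF.insert x).monotone_row r (not_lt.1 h)
      rw [insertFilling_bump h2] at this
      exact absurd (h3.trans_le this) (not_lt.2 ih)
    rw [insertFilling_of_not fun h => h4.ne' h.2]
    exact hF.monotone_row r h4.le

/-- The second half of the row bumping lemma. -/
theorem carried_insert_lt_carried {F : ℕ → ℕ → WithTop ℕ} (hF : IsFilling F) {x y : ℕ}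
    (hxy : y < x) (r : ℕ) (h : carried F x r ≠ ⊤) :
    carried (insertFilling F x) y r < carried F x r := by
  -- The place filled by the first insertion now holds a letter larger than the second one, so the
  -- second bump happens weakly to its left and expels at most that letter.
  have step : ∀ r, carried F x r ≠ ⊤ → carried (insertFilling F x) y r < carried F x r →
      carried (insertFilling F x) y (r + 1) ≤ carried F x r := by
    intro r h1 h2
    rw [carried_succ h2.ne_top]
    have h3 : bumpColumn (insertFilling F x) r (carried (insertFilling F x) y r) ≤
        bumpColumn F r (carried F x r) :=
      bumpColumn_le (by rwa [insertFilling_bump h1])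
    have := (hF.insert x).monotone_row r h3
    rwa [insertFilling_bump h1] at this
  induction r with
  | zero => simpa [carried] using hxy
  | succ r ih =>
    have h1 := carried_ne_top_of_succ h
    exact (step r h1 (ih h1)).trans_lt (carried_lt_succ hF h1)

/-- The smaller second letter bumps weakly to the left of the place just filled, hence bumps a
genuine entry. So the second insertion always gets one row further than the first. -/
theorem carried_insert_succ_ne_top {F : ℕ → ℕ → WithTop ℕ} (hF : IsFilling F) {x y : ℕ}
    (hxy : y < x) (r : ℕ) (h : carried F x r ≠ ⊤) :
    carried (insertFilling F x) y (r + 1) ≠ ⊤ := by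
  have h2 := carried_insert_lt_carried hF hxy r h
  rw [carried_succ h2.ne_top]
  have h3 : bumpColumn (insertFilling F x) r (carried (insertFilling F x) y r) ≤
      bumpColumn F r (carried F x r) :=
    bumpColumn_le (by rwa [insertFilling_bump h])
  have := (hF.insert x).monotone_row r h3
  rw [insertFilling_bump h] at this
  exact ne_top_of_le_ne_top h this

/-! ### Row insertion is invertible -/

theorem insertFilling_zero (F : ℕ → ℕ → WithTop ℕ) (x c : ℕ) :
    insertFilling F x 0 c = if c = bumpColumn F 0 x then (x : WithTop ℕ) else F 0 c := by
  simp [insertFilling, carried]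

/-- Insertion is recursive: below row 0 it is the insertion of the bumped letter into the remaining
rows. This is what permits induction on rows. -/
theorem carried_tail {F : ℕ → ℕ → WithTop ℕ} {x y : ℕ} (h : F 0 (bumpColumn F 0 x) = y) (r : ℕ) :
    carried F x (r + 1) = carried (fun s => F (s + 1)) y r := by
  induction r with
  | zero => simp [carried, h]
  | succ r ih =>
    rw [carried, ih, carried]
    rfl

theorem insertFilling_tail {F : ℕ → ℕ → WithTop ℕ} {x y : ℕ} (h : F 0 (bumpColumn F 0 x) = y)
    (r c : ℕ) : insertFilling F x (r + 1) c = insertFilling (fun s => F (s + 1)) y r c := by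
  unfold insertFilling
  rw [carried_tail h]
  rfl

theorem insertFilling_tail_of_top {F : ℕ → ℕ → WithTop ℕ} {x : ℕ}
    (h : F 0 (bumpColumn F 0 x) = ⊤) (r c : ℕ) : insertFilling F x (r + 1) c = F (r + 1) c := by
  have h1 : ∀ r, carried F x (r + 1) = ⊤ := by
    intro r
    induction r with
    | zero => simp [carried, h]
    | succ r ih => rw [carried, if_pos ih]
  exact insertFilling_of_not fun h2 => h2.1 (h1 r)

/-- Equality of the original shapes fixes where the bumping path ends. By induction on rows the
lower rows determine the letter bumped out of row 0, and that letter determines its column. -/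
theorem insertFilling_injective {F F' : ℕ → ℕ → WithTop ℕ} (hF : IsFilling F)
    (hF' : IsFilling F') {x x' : ℕ} (h : insertFilling F x = insertFilling F' x')
    (hs : ∀ r c, F r c = ⊤ ↔ F' r c = ⊤) : F = F' ∧ x = x' := by
  obtain ⟨R, hR⟩ := hF.exists_row_top
  induction R generalizing F F' x x' with
  | zero | succ R ih =>
  have h0 : ∀ c, (if c = bumpColumn F 0 x then (x : WithTop ℕ) else F 0 c) =
      if c = bumpColumn F' 0 x' then (x' : WithTop ℕ) else F' 0 c := fun c => by
    rw [← insertFilling_zero, ← insertFilling_zero, h]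
  have hsame : bumpColumn F 0 x = bumpColumn F' 0 x' →
      (F 0 (bumpColumn F 0 x) = F' 0 (bumpColumn F 0 x)) →
      (∀ r c, F (r + 1) c = F' (r + 1) c) → F = F' ∧ x = x' := by
    intro hk hy ht
    have hx : x = x' := by
      have := h0 (bumpColumn F 0 x)
      rw [if_pos rfl, if_pos hk] at this
      exact_mod_cast this
    refine ⟨?_, hx⟩
    funext r c
    cases r with
    | zero =>
      by_cases hc : c = bumpColumn F 0 x
      · rw [hc, hy]
      · have := h0 c
        rwa [if_neg hc, if_neg (hk ▸ hc)] at this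
    | succ r => exact ht r c
  by_cases hy : F 0 (bumpColumn F 0 x) = ⊤
  -- Here the insertion ends in row 0 with a new box. At another column the other result would still
  -- show an old entry there, which is `⊤` by equality of shapes.
  · have hk : bumpColumn F 0 x = bumpColumn F' 0 x' := by
      by_contra hk
      have := h0 (bumpColumn F 0 x)
      rw [if_pos rfl, if_neg hk, (hs _ _).1 hy] at this
      simp at this
    refine hsame hk (hy.trans ((hs _ _).1 hy).symm) fun r c => ?_
    rw [← insertFilling_tail_of_top hy, ← insertFilling_tail_of_top (F := F') (x := x'), h]
    rw [← hk, ← hs, hy]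
  by_cases hy' : F' 0 (bumpColumn F' 0 x') = ⊤
  · have hk : bumpColumn F 0 x = bumpColumn F' 0 x' := by
      by_contra hk
      have := h0 (bumpColumn F' 0 x')
      rw [if_pos rfl, if_neg (Ne.symm hk), (hs _ _).2 hy'] at this
      simp at this
    exact absurd ((hs _ _).2 (hk ▸ hy')) hy
  -- In the base case row 0 is empty, so nothing could be bumped from it; the first alternative
  -- closes that case and the second is the inductive step.
  first
  | exact absurd (top_le_iff.1 (hR ▸ hF.monotone_row 0 (Nat.zero_le _))) hy
  | obtain ⟨y, hy⟩ := exists_natCast_eq hy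
    obtain ⟨y', hy'⟩ := exists_natCast_eq hy'
    have ht := ih hF.tail hF'.tail (x := y) (x' := y')
      (by
        funext r c
        rw [← insertFilling_tail hy.symm, ← insertFilling_tail hy'.symm, h])
      (fun r c => hs (r + 1) c) hR
    have hyy := ht.2
    have hx : (x : WithTop ℕ) < y := by
      rw [hy]; exact hF.lt_bumpColumn 0 (by simp)
    have hx' : (x' : WithTop ℕ) < y' := by
      rw [hy']; exact hF'.lt_bumpColumn 0 (by simp)
    -- If one column were further left, the common bumped letter, found there in its filling, would
    -- be at most the letter inserted further right in the other filling. But an inserted letter is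
    -- smaller than what it bumps.
    have hk : bumpColumn F 0 x = bumpColumn F' 0 x' := by
      rcases lt_trichotomy (bumpColumn F 0 x) (bumpColumn F' 0 x') with hk | hk | hk
      · have h1 := h0 (bumpColumn F' 0 x')
        rw [if_pos rfl, if_neg hk.ne'] at h1
        have h2 := hF.monotone_row 0 hk.le
        rw [h1, ← hy, hyy] at h2
        exact absurd hx' (not_lt.2 h2)
      · exact hk
      · have h1 := h0 (bumpColumn F 0 x)
        rw [if_pos rfl, if_neg hk.ne'] at h1
        have h2 := hF'.monotone_row 0 hk.le
        rw [← h1, ← hy', ← hyy] at h2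
        exact absurd hx (not_lt.2 h2)
    refine hsame hk ?_ fun r c => congrFun (congrFun ht.1 r) c
    rw [← hy, hk, ← hy', hyy]

theorem bumpColumn_eq {F : ℕ → ℕ → WithTop ℕ} {r k : ℕ} {x : WithTop ℕ} (h : x < F r k)
    (h' : ∀ c < k, F r c ≤ x) : bumpColumn F r x = k := by
  refine le_antisymm (bumpColumn_le h) ?_
  by_contra hk
  have h1 : x < F r (bumpColumn F r x) := Nat.sInf_mem (s := {c | x < F r c}) ⟨k, h⟩
  exact absurd h1 (not_lt.2 (h' _ (not_le.1 hk)))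

/-- Reverse row insertion from an outside corner. -/
theorem exists_insertFilling_eq {G : ℕ → ℕ → WithTop ℕ} (hG : IsFilling G) {r₀ c₀ : ℕ}
    (h1 : G r₀ c₀ ≠ ⊤) (h2 : G r₀ (c₀ + 1) = ⊤) (h3 : G (r₀ + 1) c₀ = ⊤) :
    ∃ F x, IsFilling F ∧ insertFilling F x = G ∧
      ∀ r c, F r c = ⊤ ↔ G r c = ⊤ ∨ (r = r₀ ∧ c = c₀) := by
  induction r₀ generalizing G with
  | zero =>
    obtain ⟨x, hx⟩ := exists_natCast_eq h1
    have hs : ∀ r c, (if r = 0 ∧ c = c₀ then ⊤ else G r c) = ⊤ ↔ G r c = ⊤ ∨ (r = 0 ∧ c = c₀) := by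
      intro r c
      split_ifs with h
      · simp [h]
      · simp [h]
    have hge : ∀ c, c₀ < c → G 0 c = ⊤ := fun c hc =>
      top_le_iff.1 (h2 ▸ hG.monotone_row 0 hc)
    have hb : bumpColumn (fun r c => if r = 0 ∧ c = c₀ then ⊤ else G r c) 0 (x : WithTop ℕ) = c₀ := by
      refine bumpColumn_eq (by simp) fun c hc => ?_
      simp only [true_and, if_neg hc.ne]
      rw [hx]
      exact hG.monotone_row 0 hc.le
    refine ⟨fun r c => if r = 0 ∧ c = c₀ then ⊤ else G r c, x, ⟨?_, ?_, ?_⟩, ?_, hs⟩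
    · intro r c
      split_ifs with h4 h5 h5
      · omega
      · rw [h4.1, hge _ (by omega)]
      · exact le_top
      · exact hG.row r c
    · intro r c
      rw [if_neg (by omega)]
      split_ifs with h4
      · rw [h4.1, h4.2, h3]
        simp
      · exact hG.col r c
    · refine hG.finite.subset ?_
      rintro ⟨r, c⟩ h
      exact fun h' => h ((hs r c).2 (Or.inl h'))
    · funext r c
      cases r with
      | zero =>
        rw [insertFilling_zero, hb]
        split_ifs with h4
        · rw [h4, hx]
        · omega
        · rfl
      | succ r =>
        rw [insertFilling_tail_of_top (by rw [hb]; simp)]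
        simp
  | succ r₀ ih =>
    obtain ⟨F', y, hF', hins, hs⟩ := ih hG.tail h1 h2 h3
    set b := bumpColumn F' 0 (y : WithTop ℕ) with hb
    have hyb : G 1 b = y := by
      have := congrFun (congrFun hins 0) b
      rw [insertFilling_zero, if_pos rfl] at this
      exact this.symm
    have h0b : G 0 b < y := hyb ▸ hG.col 0 b (by simp [hyb])
    -- The letter expelled upwards returns to the last place of row 0 whose entry is smaller; that
    -- entry is the one to be expelled in turn.
    obtain ⟨k, hk, hk'⟩ : ∃ k, G 0 k < y ∧ (y : WithTop ℕ) ≤ G 0 (k + 1) := by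
      by_contra! h
      have hall : ∀ c, b ≤ c → G 0 c < y := fun c hc => by
        induction c, hc using Nat.le_induction with
        | base => exact h0b
        | succ c _ ih => exact h c ih
      obtain ⟨c, hc⟩ := hG.exists_top 0
      have h4 := hall (max b c) (le_max_left _ _)
      exact absurd (top_le_iff.1 (hc ▸ hG.monotone_row 0 (le_max_right b c))) h4.ne_top
    have hbk : b ≤ k := by
      by_contra h
      exact absurd ((hk'.trans (hG.monotone_row 0 (by omega : k + 1 ≤ b))).trans_lt h0b)
        (lt_irrefl _)
    obtain ⟨x, hx⟩ := exists_natCast_eq hk.ne_top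
    have hyF : (y : WithTop ℕ) < F' 0 k :=
      (hF'.lt_bumpColumn 0 (by simp)).trans_le (hF'.monotone_row 0 hbk)
    -- Undoing an insertion only raises entries, so the columns stay strict between row 0 and the
    -- rows restored below it.
    have hle : ∀ c, G 1 c ≤ F' 0 c := fun c => by
      have := congrFun (congrFun hins 0) c
      rw [insertFilling_zero] at this
      rw [zero_add] at this
      rw [← this]
      split_ifs with h
      · rw [h]
        exact (hF'.lt_bumpColumn 0 (by simp)).le
      · exact le_rfl
    let F : ℕ → ℕ → WithTop ℕ := fun r c =>
      match r with
      | 0 => if c = k then (y : WithTop ℕ) else G 0 c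
      | r + 1 => F' r c
    have hF0 : ∀ c, F 0 c = if c = k then (y : WithTop ℕ) else G 0 c := fun c => rfl
    have hbF : bumpColumn F 0 (x : WithTop ℕ) = k := by
      refine bumpColumn_eq ?_ fun c hc => ?_
      · rw [hF0, if_pos rfl, hx]
        exact hk
      · rw [hF0, if_neg hc.ne, hx]
        exact hG.monotone_row 0 hc.le
    have hs' : ∀ r c, F r c = ⊤ ↔ G r c = ⊤ ∨ (r = r₀ + 1 ∧ c = c₀) := by
      rintro (_ | r) c
      · rw [hF0]
        split_ifs with h
        · simp [h, hk.ne_top]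
        · simp
      · change F' r c = ⊤ ↔ _
        rw [hs]
        simp
    refine ⟨F, x, ⟨?_, ?_, ?_⟩, ?_, hs'⟩
    · rintro (_ | r) c
      · rw [hF0, hF0]
        split_ifs with h4 h5 h5
        · exact le_rfl
        · rw [h4]; exact hk'
        · exact (h5 ▸ hG.row 0 c).trans hk.le
        · exact hG.row 0 c
      · exact hF'.row r c
    · rintro (_ | r) c
      · intro hne
        change _ < F' 0 c
        rw [hF0]
        split_ifs with h4
        · rw [h4]; exact hyF
        · by_cases h5 : G 1 c = ⊤
          · have h6 : F' 0 c = ⊤ := top_le_iff.1 (h5 ▸ hle c)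
            exact absurd h6 hne
          · exact (hG.col 0 c h5).trans_le (hle c)
      · exact hF'.col r c
    · refine hG.finite.subset ?_
      rintro ⟨r, c⟩ h
      exact fun h' => h ((hs' r c).2 (Or.inl h'))
    · funext r c
      cases r with
      | zero =>
        rw [insertFilling_zero, hbF, hF0]
        split_ifs with h4
        · rw [h4, hx]
        · rfl
      | succ r =>
        rw [insertFilling_tail (y := y) (by rw [hbF, hF0, if_pos rfl])]
        exact congrFun (congrFun hins r) c

/-! ### Sliding from the corner -/

/-- The hole that starts in the corner `(0, 0)` visits `(r, c)`. -/
def OnPath (F : ℕ → ℕ → WithTop ℕ) (r c : ℕ) : Prop :=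
  holePath F (0, 0) (r + c) = (r, c)

/-- Each step moves to the next antidiagonal. The path thus meets every antidiagonal exactly once,
and the time of a visit can be read off from its position. -/
theorem holePath_sum (F : ℕ → ℕ → WithTop ℕ) (k : ℕ) :
    (holePath F (0, 0) k).1 + (holePath F (0, 0) k).2 = k := by
  induction k with
  | zero => rfl
  | succ k ih =>
    simp only [holePath]
    split_ifs <;> simp only <;> omega

theorem exists_holePath_eq_iff {F : ℕ → ℕ → WithTop ℕ} {r c : ℕ} :
    (∃ k, holePath F (0, 0) k = (r, c)) ↔ OnPath F r c := by
  refine ⟨fun ⟨k, hk⟩ => ?_, fun h => ⟨_, h⟩⟩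
  have := holePath_sum F k
  rw [hk] at this
  rw [OnPath, ← hk, this]

theorem OnPath.unique {F : ℕ → ℕ → WithTop ℕ} {r c s d : ℕ} (h1 : OnPath F r c)
    (h2 : OnPath F s d) (h : r + c = s + d) : r = s ∧ c = d := by
  rw [OnPath] at h1 h2
  rw [← h, h1] at h2
  exact Prod.mk.inj h2

theorem onPath_zero (F : ℕ → ℕ → WithTop ℕ) : OnPath F 0 0 := rfl

theorem exists_onPath (F : ℕ → ℕ → WithTop ℕ) (m : ℕ) : ∃ r c, r + c = m ∧ OnPath F r c :=
  ⟨_, _, holePath_sum F m, by rw [OnPath, holePath_sum]⟩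

theorem OnPath.down {F : ℕ → ℕ → WithTop ℕ} {r c : ℕ} (h : OnPath F r c)
    (hle : F (r + 1) c ≤ F r (c + 1)) : OnPath F (r + 1) c := by
  rw [OnPath] at h ⊢
  rw [show r + 1 + c = r + c + 1 by omega, holePath, h]
  exact if_pos hle

theorem OnPath.right {F : ℕ → ℕ → WithTop ℕ} {r c : ℕ} (h : OnPath F r c)
    (hlt : F r (c + 1) < F (r + 1) c) : OnPath F r (c + 1) := by
  rw [OnPath] at h ⊢
  rw [← add_assoc, holePath, h]
  exact if_neg (not_le.2 hlt)

theorem OnPath.pred {F : ℕ → ℕ → WithTop ℕ} {r c : ℕ} (h : OnPath F r c) (h0 : r + c ≠ 0) :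
    (∃ r', r = r' + 1 ∧ OnPath F r' c ∧ F (r' + 1) c ≤ F r' (c + 1)) ∨
      ∃ c', c = c' + 1 ∧ OnPath F r c' ∧ F r (c' + 1) < F (r + 1) c' := by
  obtain ⟨m, hm⟩ := Nat.exists_eq_succ_of_ne_zero h0
  obtain ⟨s, d, hsd, hp⟩ := exists_onPath F m
  rcases le_or_gt (F (s + 1) d) (F s (d + 1)) with hle | hlt
  · obtain ⟨rfl, rfl⟩ := h.unique (hp.down hle) (by omega)
    exact Or.inl ⟨s, rfl, hp, hle⟩
  · obtain ⟨rfl, rfl⟩ := h.unique (hp.right hlt) (by omega)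
    exact Or.inr ⟨d, rfl, hp, hlt⟩

theorem OnPath.mono {F : ℕ → ℕ → WithTop ℕ} {r c s d : ℕ} (h1 : OnPath F r c)
    (h2 : OnPath F s d) (h : r + c ≤ s + d) : r ≤ s ∧ c ≤ d := by
  obtain ⟨m, hm⟩ := Nat.exists_eq_add_of_le h
  induction m generalizing s d with
  | zero =>
    obtain ⟨rfl, rfl⟩ := h1.unique h2 (by omega)
    exact ⟨le_rfl, le_rfl⟩
  | succ m ih =>
    rcases h2.pred (by omega) with ⟨s', rfl, h3, -⟩ | ⟨d', rfl, h3, -⟩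
    · have := ih h3 (by omega) (by omega)
      omega
    · have := ih h3 (by omega) (by omega)
      omega

theorem slideFilling_of_onPath {F : ℕ → ℕ → WithTop ℕ} {r c : ℕ} (h : OnPath F r c) :
    slideFilling F (0, 0) r c = min (F (r + 1) c) (F r (c + 1)) :=
  if_pos (exists_holePath_eq_iff.2 h)

theorem slideFilling_of_not_onPath {F : ℕ → ℕ → WithTop ℕ} {r c : ℕ} (h : ¬ OnPath F r c) :
    slideFilling F (0, 0) r c = F r c :=
  if_neg fun h' => h (exists_holePath_eq_iff.1 h')

theorem slideFilling_step {F : ℕ → ℕ → WithTop ℕ} {r c s d : ℕ} (h1 : OnPath F r c)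
    (h2 : OnPath F s d) (h : s + d = r + c + 1) : slideFilling F (0, 0) r c = F s d := by
  rw [slideFilling_of_onPath h1]
  rcases le_or_gt (F (r + 1) c) (F r (c + 1)) with hle | hlt
  · obtain ⟨rfl, rfl⟩ := h2.unique (h1.down hle) (by omega)
    exact min_eq_left hle
  · obtain ⟨rfl, rfl⟩ := h2.unique (h1.right hlt) (by omega)
    exact min_eq_right hlt.le

/-- During a slide an entry stays in its place, moves up or moves to the left. -/
theorem slideFilling_entry {F : ℕ → ℕ → WithTop ℕ} {r c : ℕ} (h0 : r + c ≠ 0) :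
    (¬ OnPath F r c ∧ slideFilling F (0, 0) r c = F r c) ∨
    (∃ r', r = r' + 1 ∧ OnPath F r' c ∧ F (r' + 1) c ≤ F r' (c + 1) ∧
      slideFilling F (0, 0) r' c = F r c) ∨
    ∃ c', c = c' + 1 ∧ OnPath F r c' ∧ F r (c' + 1) < F (r + 1) c' ∧
      slideFilling F (0, 0) r c' = F r c := by
  by_cases h : OnPath F r c
  · rcases h.pred h0 with ⟨r', rfl, h1, h2⟩ | ⟨c', rfl, h1, h2⟩
    · exact Or.inr (Or.inl ⟨r', rfl, h1, h2, slideFilling_step h1 h (by omega)⟩)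
    · exact Or.inr (Or.inr ⟨c', rfl, h1, h2, slideFilling_step h1 h (by omega)⟩)
  · exact Or.inl ⟨h, slideFilling_of_not_onPath h⟩

theorem slideFilling_source (F : ℕ → ℕ → WithTop ℕ) (r c : ℕ) :
    ∃ s d, slideFilling F (0, 0) r c = F s d ∧ s + d ≠ 0 ∧
      ((¬ OnPath F r c ∧ r = s ∧ c = d) ∨
        (OnPath F r c ∧ OnPath F s d ∧ s + d = r + c + 1)) := by
  by_cases h : OnPath F r c
  · obtain ⟨s, d, hsd, hp⟩ := exists_onPath F (r + c + 1)
    exact ⟨s, d, slideFilling_step h hp hsd, by omega, Or.inr ⟨h, hp, hsd⟩⟩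
  · refine ⟨r, c, slideFilling_of_not_onPath h, fun h0 => h ?_, Or.inl ⟨h, rfl, rfl⟩⟩
    obtain ⟨rfl, rfl⟩ : r = 0 ∧ c = 0 := by omega
    exact onPath_zero F

theorem hasEntry_slideFilling {F : ℕ → ℕ → WithTop ℕ} (hd : EntriesDistinct F) {v : ℕ} :
    HasEntry (slideFilling F (0, 0)) v ↔ HasEntry F v ∧ F 0 0 ≠ v := by
  constructor
  · rintro ⟨r, c, h⟩
    obtain ⟨s, d, h1, h2, -⟩ := slideFilling_source F r c
    rw [h] at h1
    refine ⟨⟨s, d, h1.symm⟩, fun h3 => h2 ?_⟩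
    obtain ⟨rfl, rfl⟩ := hd s d 0 0 (h1.symm.trans h3.symm) (by simp [← h1])
    rfl
  · rintro ⟨⟨r, c, h⟩, h1⟩
    have h0 : r + c ≠ 0 := fun h0 => by
      obtain ⟨rfl, rfl⟩ : r = 0 ∧ c = 0 := by omega
      exact h1 h
    rcases slideFilling_entry (F := F) h0 with ⟨-, h2⟩ | ⟨_, -, -, -, h2⟩ | ⟨_, -, -, -, h2⟩
    all_goals exact ⟨_, _, h2.trans h⟩

theorem EntriesDistinct.slide {F : ℕ → ℕ → WithTop ℕ} (hd : EntriesDistinct F) :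
    EntriesDistinct (slideFilling F (0, 0)) := by
  intro r c r' c' h hne
  obtain ⟨s, d, h1, -, h2⟩ := slideFilling_source F r c
  obtain ⟨s', d', h1', -, h2'⟩ := slideFilling_source F r' c'
  obtain ⟨rfl, rfl⟩ := hd s d s' d' (h1 ▸ h1' ▸ h) (h1 ▸ hne)
  rcases h2 with ⟨h2, rfl, rfl⟩ | ⟨h2, h3, h4⟩ <;>
    rcases h2' with ⟨h2', rfl, rfl⟩ | ⟨h2', h3', h4'⟩
  · exact ⟨rfl, rfl⟩
  · exact absurd h3' h2
  · exact absurd h3 h2'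
  · exact h2.unique h2' (by omega)

/-- The last box of the diagram that the hole visits. -/
theorem IsFilling.exists_lastBox {F : ℕ → ℕ → WithTop ℕ} (hF : IsFilling F) (h0 : F 0 0 ≠ ⊤) :
    ∃ R C, OnPath F R C ∧ F R C ≠ ⊤ ∧ F (R + 1) C = ⊤ ∧ F R (C + 1) = ⊤ := by
  by_contra! h
  have hall : ∀ k, F (holePath F (0, 0) k).1 (holePath F (0, 0) k).2 ≠ ⊤ := by
    intro k
    induction k with
    | zero => exact h0
    | succ k ih =>
      set q := holePath F (0, 0) k with hq
      have hp : OnPath F q.1 q.2 := by rw [OnPath, hq, holePath_sum]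
      have h1 := h q.1 q.2 hp ih
      simp only [holePath, ← hq]
      split_ifs with hle
      · intro h2
        exact h1 h2 (top_le_iff.1 (h2 ▸ hle))
      · exact (not_le.1 hle).ne_top
  -- A hole that never reached an outside corner would visit infinitely many boxes of a finite
  -- diagram.
  refine Set.infinite_of_injective_forall_mem (f := holePath F (0, 0)) (fun a b hab => ?_)
    hall hF.finite
  rw [← holePath_sum F a, hab, holePath_sum]

theorem OnPath.eq_top_of_lt {F : ℕ → ℕ → WithTop ℕ} (hF : IsFilling F) {R C r c : ℕ}
    (hp : OnPath F R C) (h1 : F (R + 1) C = ⊤) (h2 : F R (C + 1) = ⊤) (h : OnPath F r c)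
    (hlt : R + C < r + c) : F r c = ⊤ := by
  have hm := hp.mono h hlt.le
  rcases lt_or_eq_of_le hm.1 with h3 | h3
  · exact top_le_iff.1 (h1 ▸ hF.mono h3 hm.2)
  · exact top_le_iff.1 (h2 ▸ hF.mono hm.1 (by omega : C + 1 ≤ c))

theorem slideFilling_ne_top_iff {F : ℕ → ℕ → WithTop ℕ} (hF : IsFilling F) {R C : ℕ}
    (hp : OnPath F R C) (hne : F R C ≠ ⊤) (h1 : F (R + 1) C = ⊤) (h2 : F R (C + 1) = ⊤)
    (r c : ℕ) : slideFilling F (0, 0) r c ≠ ⊤ ↔ F r c ≠ ⊤ ∧ ¬ (r = R ∧ c = C) := by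
  constructor
  · intro h
    refine ⟨ne_top_of_le_ne_top h (hF.le_slide _ _ _), ?_⟩
    rintro ⟨rfl, rfl⟩
    rw [slideFilling_of_onPath hp, h1, h2] at h
    exact h (min_self _)
  · rintro ⟨h3, h4⟩ h5
    by_cases h6 : OnPath F r c
    · rw [slideFilling_of_onPath h6, min_eq_top] at h5
      rcases lt_trichotomy (R + C) (r + c) with h7 | h7 | h7
      · exact h3 (hp.eq_top_of_lt hF h1 h2 h6 h7)
      · obtain ⟨rfl, rfl⟩ := hp.unique h6 h7
        exact h4 ⟨rfl, rfl⟩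
      · exact hne (h6.eq_top_of_lt hF h5.1 h5.2 hp h7)
    · exact h3 (slideFilling_of_not_onPath h6 ▸ h5)

/-! ### Sliding is invertible -/

/-- The shapes identify the last box of the hole's path, and the slid filling shows at each box
whether the hole came from above or from the left. So both paths agree, and shifting back along them
recovers the filling. -/
theorem slideFilling_injective {F F' : ℕ → ℕ → WithTop ℕ} (hF : IsFilling F) (hF' : IsFilling F')
    (h : slideFilling F (0, 0) = slideFilling F' (0, 0)) (hs : ∀ r c, F r c = ⊤ ↔ F' r c = ⊤)
    (h0 : F 0 0 = F' 0 0) (hne : F 0 0 ≠ ⊤) : F = F' := by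
  obtain ⟨R, C, hp, h1, h2, h3⟩ := hF.exists_lastBox hne
  obtain ⟨R', C', hp', h1', h2', h3'⟩ := hF'.exists_lastBox (h0 ▸ hne)
  obtain ⟨rfl, rfl⟩ : R = R' ∧ C = C' := by
    by_contra hcon
    have h4 := (slideFilling_ne_top_iff hF' hp' h1' h2' h3' R C).2
      ⟨fun h5 => h1 ((hs _ _).2 h5), hcon⟩
    rw [← h] at h4
    exact ((slideFilling_ne_top_iff hF hp h1 h2 h3 R C).1 h4).2 ⟨rfl, rfl⟩
  have common : ∀ j ≤ R + C, ∃ r c, r + c = R + C - j ∧ OnPath F r c ∧ OnPath F' r c := by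
    intro j
    induction j with
    | zero => exact fun _ => ⟨R, C, rfl, hp, hp'⟩
    | succ j ih =>
      intro hj
      obtain ⟨r, c, hrc, hq, hq'⟩ := ih (by omega)
      have hm := hq.mono hp (by omega)
      have hfin' : F' r c ≠ ⊤ := ne_top_of_le_ne_top h1' (hF'.mono hm.1 hm.2)
      have hfin : F r c ≠ ⊤ := ne_top_of_le_ne_top h1 (hF.mono hm.1 hm.2)
      -- Compare the slid entries above and to the left of the box. Arrival from above forces left ≤
      -- above by weak rows; arrival from the left forces above < left by strict columns.
      have mixed : ∀ {A B : ℕ → ℕ → WithTop ℕ}, IsFilling A → IsFilling B →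
          slideFilling A (0, 0) = slideFilling B (0, 0) → ∀ {a b}, B (a + 1) (b + 1) ≠ ⊤ →
          OnPath A (a + 1) (b + 1) → OnPath B (a + 1) (b + 1) → OnPath A a (b + 1) →
          OnPath B (a + 1) b → False := by
        intro A B hA hB hAB a b hfin hA1 hB1 hA2 hB2
        have e1 := slideFilling_step hA2 hA1 (by omega)
        have e2 := slideFilling_step hB2 hB1 (by omega)
        have e3 : slideFilling A (0, 0) (a + 1) b = A (a + 1) b :=
          slideFilling_of_not_onPath fun h' => by have := h'.unique hA2 (by omega); omega
        have e4 : slideFilling B (0, 0) a (b + 1) = B a (b + 1) :=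
          slideFilling_of_not_onPath fun h' => by have := h'.unique hB2 (by omega); omega
        have e5 := hA.row (a + 1) b
        have e6 := hB.col a (b + 1) hfin
        rw [← e1, ← e3, hAB] at e5
        rw [← e4, ← e2] at e6
        exact absurd e6 (not_lt.2 e5)
      rcases hq.pred (by omega) with ⟨a, rfl, hA, -⟩ | ⟨b, rfl, hA, -⟩ <;>
        rcases hq'.pred (by omega) with ⟨a', ha, hB, -⟩ | ⟨b', hb, hB, -⟩
      · obtain rfl : a' = a := by omega
        exact ⟨a', c, by omega, hA, hB⟩
      · subst hb
        exact (mixed hF hF' h hfin' hq hq' hA hB).elim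
      · subst ha
        exact (mixed hF' hF h.symm hfin hq' hq hB hA).elim
      · obtain rfl : b' = b := by omega
        exact ⟨r, b', by omega, hA, hB⟩
  have common' : ∀ m ≤ R + C, ∃ r c, r + c = m ∧ OnPath F r c ∧ OnPath F' r c := by
    intro m hm
    obtain ⟨r, c, h4, h5⟩ := common (R + C - m) (by omega)
    exact ⟨r, c, by omega, h5⟩
  have key : ∀ {A : ℕ → ℕ → WithTop ℕ}, IsFilling A → OnPath A R C → A (R + 1) C = ⊤ →
      A R (C + 1) = ⊤ → ∀ r c, R + C < r + c → slideFilling A (0, 0) r c = A r c := by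
    intro A hA hp h2 h3 r c hlt
    by_cases h4 : OnPath A r c
    · have h5 := hp.eq_top_of_lt hA h2 h3 h4 hlt
      rw [h5]
      exact top_le_iff.1 (h5 ▸ hA.le_slide _ _ _)
    · exact slideFilling_of_not_onPath h4
  funext r c
  by_cases hrc : R + C < r + c
  · rw [← key hF hp h2 h3 r c hrc, ← key hF' hp' h2' h3' r c hrc, h]
  obtain ⟨s, d, h4, h5, h6⟩ := common' (r + c) (by omega)
  by_cases h7 : OnPath F r c
  · obtain ⟨rfl, rfl⟩ := h7.unique h5 h4.symm
    rcases Nat.eq_zero_or_pos (r + c) with h8 | h8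
    · obtain ⟨rfl, rfl⟩ : r = 0 ∧ c = 0 := by omega
      exact h0
    · obtain ⟨s, d, h9, h10, h11⟩ := common' (r + c - 1) (by omega)
      rw [← slideFilling_step h10 h5 (by omega), ← slideFilling_step h11 h6 (by omega), h]
  · have h8 : ¬ OnPath F' r c := fun h8 => by
      obtain ⟨rfl, rfl⟩ := h8.unique h6 h4.symm
      exact h7 h5
    rw [← slideFilling_of_not_onPath h7, ← slideFilling_of_not_onPath h8, h]

/-- The reverse slide into the corner `(0, 0)` from `(r₀, c₀)`: the larger of the entries to the
left and above moves into the hole. -/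
theorem exists_reversePath (G : ℕ → ℕ → WithTop ℕ) (r₀ c₀ : ℕ) :
    ∃ p : ℕ → ℕ × ℕ, p 0 = (0, 0) ∧ p (r₀ + c₀) = (r₀, c₀) ∧ ∀ k,
      (p (k + 1) = ((p k).1 + 1, (p k).2) ∧ (k < r₀ + c₀ → ∀ c, (p k).2 = c + 1 →
        G ((p k).1 + 1) c ≤ G (p k).1 (p k).2)) ∨
      (p (k + 1) = ((p k).1, (p k).2 + 1) ∧ k < r₀ + c₀ ∧ ∀ r, (p k).1 = r + 1 →
        G r ((p k).2 + 1) < G (p k).1 (p k).2) := by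
  obtain ⟨K, hK⟩ : ∃ K, r₀ + c₀ = K := ⟨_, rfl⟩
  rw [hK]
  induction K generalizing r₀ c₀ with
  | zero =>
    obtain ⟨rfl, rfl⟩ : r₀ = 0 ∧ c₀ = 0 := by omega
    exact ⟨fun k => (k, 0), rfl, rfl, fun k => Or.inl ⟨rfl, fun h => absurd h (by omega)⟩⟩
  | succ K ih =>
    have extend : ∀ r₁ c₁, r₁ + c₁ = K →
        ((r₀, c₀) = (r₁ + 1, c₁) ∧ ∀ c, c₁ = c + 1 → G (r₁ + 1) c ≤ G r₁ c₁) ∨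
        ((r₀, c₀) = (r₁, c₁ + 1) ∧ ∀ r, r₁ = r + 1 → G r (c₁ + 1) < G r₁ c₁) →
        ∃ p : ℕ → ℕ × ℕ, p 0 = (0, 0) ∧ p (K + 1) = (r₀, c₀) ∧ ∀ k,
      (p (k + 1) = ((p k).1 + 1, (p k).2) ∧ (k < K + 1 → ∀ c, (p k).2 = c + 1 →
        G ((p k).1 + 1) c ≤ G (p k).1 (p k).2)) ∨
      (p (k + 1) = ((p k).1, (p k).2 + 1) ∧ k < K + 1 ∧ ∀ r, (p k).1 = r + 1 →
        G r ((p k).2 + 1) < G (p k).1 (p k).2) := by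
      intro r₁ c₁ h1 h2
      obtain ⟨p, hp0, hpK, hp⟩ := ih r₁ c₁ h1
      -- Beyond the target the path runs straight down, matching the convention for a hole whose two
      -- neighbours are both `⊤`.
      refine ⟨fun k => if k ≤ K then p k else (r₀ + (k - (K + 1)), c₀), by simp [hp0], by simp,
        fun k => ?_⟩
      rcases lt_trichotomy k K with h3 | rfl | h3
      · simp only [if_pos h3.le, if_pos (Nat.succ_le_of_lt h3)]
        rcases hp k with h4 | h4
        · exact Or.inl ⟨h4.1, fun _ => h4.2 h3⟩
        · exact Or.inr ⟨h4.1, by omega, h4.2.2⟩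
      · simp only [le_refl, if_true, if_neg (by omega : ¬ k + 1 ≤ k), hpK, Nat.sub_self, add_zero]
        rcases h2 with h2 | h2
        · exact Or.inl ⟨h2.1, fun _ => h2.2⟩
        · exact Or.inr ⟨h2.1, by omega, h2.2⟩
      · simp only [if_neg (by omega : ¬ k ≤ K), if_neg (by omega : ¬ k + 1 ≤ K)]
        refine Or.inl ⟨?_, fun h => by omega⟩
        rw [show k + 1 - (K + 1) = k - (K + 1) + 1 by omega]
        rfl
    rcases r₀ with _ | r
    · obtain ⟨c, rfl⟩ : ∃ c, c₀ = c + 1 := ⟨c₀ - 1, by omega⟩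
      exact extend 0 c (by omega) (Or.inr ⟨rfl, fun r h => by omega⟩)
    · rcases c₀ with _ | c
      · exact extend r 0 (by omega) (Or.inl ⟨rfl, fun c h => by omega⟩)
      · rcases le_or_gt (G (r + 1) c) (G r (c + 1)) with h | h
        · refine extend r (c + 1) (by omega) (Or.inl ⟨rfl, fun c' h' => ?_⟩)
          obtain rfl : c = c' := by omega
          exact h
        · refine extend (r + 1) c (by omega) (Or.inr ⟨rfl, fun r' h' => ?_⟩)
          obtain rfl : r = r' := by omega
          exact h

/-- Shift the entries of `G` one step away from the corner along the reverse path and put `i` into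
the corner. The rule that chose the path keeps rows and columns ordered and makes the forward hole
retrace it. -/
theorem exists_slideFilling_eq {G : ℕ → ℕ → WithTop ℕ} (hG : IsFilling G)
    (hd : EntriesDistinct G) {r₀ c₀ : ℕ} (htop : G r₀ c₀ = ⊤)
    (hleft : ∀ c, c₀ = c + 1 → G r₀ c ≠ ⊤) (hup : ∀ r, r₀ = r + 1 → G r c₀ ≠ ⊤) {i : ℕ}
    (hi : ∀ r c, (i : WithTop ℕ) < G r c) :
    ∃ F, IsFilling F ∧ F 0 0 = i ∧ slideFilling F (0, 0) = G ∧
      ∀ r c, F r c = ⊤ ↔ G r c = ⊤ ∧ ¬ (r = r₀ ∧ c = c₀) := by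
  obtain ⟨p, hp0, hpK, hp⟩ := exists_reversePath G r₀ c₀
  have hsum : ∀ k, (p k).1 + (p k).2 = k := by
    intro k
    induction k with
    | zero => simp [hp0]
    | succ k ih =>
      rcases hp k with ⟨h, -⟩ | ⟨h, -⟩ <;> rw [h] <;> (simp only; omega)
  have hmono1 : Monotone fun k => (p k).1 := monotone_nat_of_le_succ fun k => by
    rcases hp k with ⟨h, -⟩ | ⟨h, -⟩ <;> simp [h]
  have hmono2 : Monotone fun k => (p k).2 := monotone_nat_of_le_succ fun k => by
    rcases hp k with ⟨h, -⟩ | ⟨h, -⟩ <;> simp [h]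
  have hge : ∀ k, r₀ + c₀ ≤ k → G (p k).1 (p k).2 = ⊤ := by
    intro k hk
    have h1 := hmono1 hk
    have h2 := hmono2 hk
    simp only [hpK] at h1 h2
    exact top_le_iff.1 (htop ▸ hG.mono h1 h2)
  have hlt : ∀ k, k < r₀ + c₀ → G (p k).1 (p k).2 ≠ ⊤ := by
    intro k hk
    obtain ⟨K, hK⟩ : ∃ K, r₀ + c₀ = K + 1 := ⟨r₀ + c₀ - 1, by omega⟩
    refine ne_top_of_le_ne_top ?_ (hG.mono (hmono1 (by omega : k ≤ K)) (hmono2 (by omega : k ≤ K)))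
    rw [hK] at hpK
    rcases hp K with ⟨h, -⟩ | ⟨h, -⟩
    · rw [hpK] at h
      have h' := Prod.mk.inj h
      simp only
      rw [← h'.2]
      exact hup _ h'.1
    · rw [hpK] at h
      have h' := Prod.mk.inj h
      simp only
      rw [← h'.1]
      exact hleft _ h'.2
  let F : ℕ → ℕ → WithTop ℕ := fun r c =>
    if p (r + c) = (r, c) then
      if r + c = 0 then (i : WithTop ℕ) else G (p (r + c - 1)).1 (p (r + c - 1)).2
    else G r c
  have hFoff : ∀ r c, p (r + c) ≠ (r, c) → F r c = G r c := fun r c h => if_neg h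
  have hF0 : F 0 0 = i := by simp [F, hp0]
  have hFstep : ∀ r c k, p (k + 1) = (r, c) → F r c = G (p k).1 (p k).2 := by
    intro r c k h
    have h1 := hsum (k + 1)
    rw [h] at h1
    simp only at h1
    simp only [F]
    rw [h1, if_pos h, if_neg (by omega), Nat.add_sub_cancel]
  have hFle : ∀ r c, F r c ≤ G r c := by
    intro r c
    by_cases h : p (r + c) = (r, c)
    · rcases Nat.eq_zero_or_pos (r + c) with h1 | h1
      · obtain ⟨rfl, rfl⟩ : r = 0 ∧ c = 0 := by omega
        rw [hF0]
        exact (hi _ _).le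
      · obtain ⟨k, hk⟩ : ∃ k, r + c = k + 1 := ⟨r + c - 1, by omega⟩
        rw [hk] at h
        rw [hFstep r c k h]
        have e1 := hmono1 (Nat.le_succ k)
        have e2 := hmono2 (Nat.le_succ k)
        simp only [Nat.succ_eq_add_one, h] at e1 e2
        exact hG.mono e1 e2
    · exact (hFoff r c h).le
  -- Shifting along a row only gives a weak inequality; distinctness of the entries makes it strict,
  -- as the column condition requires.
  have hFlt : ∀ r c, p (r + c) = (r, c) → G r c ≠ ⊤ → F r c < G r c := by
    intro r c h hne
    refine lt_of_le_of_ne (hFle r c) fun heq => ?_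
    rcases Nat.eq_zero_or_pos (r + c) with h1 | h1
    · obtain ⟨rfl, rfl⟩ : r = 0 ∧ c = 0 := by omega
      rw [hF0] at heq
      exact absurd heq (hi _ _).ne
    · obtain ⟨k, hk⟩ : ∃ k, r + c = k + 1 := ⟨r + c - 1, by omega⟩
      rw [hk] at h
      rw [hFstep r c k h] at heq
      have := hd _ _ _ _ heq (heq ▸ hne)
      have := hsum k
      omega
  have hs : ∀ r c, F r c = ⊤ ↔ G r c = ⊤ ∧ ¬ (r = r₀ ∧ c = c₀) := by
    intro r c
    constructor
    · intro h
      refine ⟨top_le_iff.1 (h ▸ hFle r c), ?_⟩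
      rintro ⟨rfl, rfl⟩
      rcases Nat.eq_zero_or_pos (r + c) with h1 | h1
      · obtain ⟨rfl, rfl⟩ : r = 0 ∧ c = 0 := by omega
        simp [hF0] at h
      · obtain ⟨k, hk⟩ : ∃ k, r + c = k + 1 := ⟨r + c - 1, by omega⟩
        rw [hFstep r c k (hk ▸ hpK)] at h
        exact hlt k (by omega) h
    · rintro ⟨h1, h2⟩
      by_cases h : p (r + c) = (r, c)
      · have h3 : r₀ + c₀ ≤ r + c := by
          by_contra h3
          have := hlt (r + c) (by omega)
          rw [h] at this
          exact this h1
        have h4 : r₀ + c₀ ≠ r + c := fun h4 => by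
          rw [h4, h] at hpK
          exact h2 (Prod.mk.inj hpK)
        obtain ⟨k, hk⟩ : ∃ k, r + c = k + 1 := ⟨r + c - 1, by omega⟩
        rw [hFstep r c k (hk ▸ h)]
        exact hge k (by omega)
      · rw [hFoff r c h, h1]
  have hF : IsFilling F := by
    refine ⟨fun r c => ?_, fun r c hne => ?_, ?_⟩
    · by_cases h2 : p (r + (c + 1)) = (r, c + 1)
      · have h2' : p (r + c + 1) = (r, c + 1) := h2
        rw [hFstep r (c + 1) (r + c) h2']
        rcases hp (r + c) with ⟨h3, h4⟩ | ⟨h3, -⟩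
        · rw [h2'] at h3
          have h5 := Prod.mk.inj h3
          by_cases h6 : r + c < r₀ + c₀
          · have h7 := h4 h6 c h5.2.symm
            rw [← h5.1] at h7
            exact (hFle r c).trans h7
          · rw [hge _ (by omega)]
            exact le_top
        · rw [h2'] at h3
          have h5 := Prod.mk.inj h3
          rw [← h5.1, show (p (r + c)).2 = c by omega]
          exact hFle r c
      · rw [hFoff r (c + 1) h2]
        exact (hFle r c).trans (hG.row r c)
    · by_cases h2 : p (r + c + 1) = (r + 1, c)
      · rw [hFstep (r + 1) c (r + c) h2] at hne ⊢
        rcases hp (r + c) with ⟨h3, -⟩ | ⟨h3, h4, h5⟩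
        · rw [h2] at h3
          have h5 := Prod.mk.inj h3
          have h6 : p (r + c) = (r, c) := Prod.ext (by simp; omega) h5.2.symm
          rw [h6] at hne ⊢
          exact hFlt r c h6 hne
        · rw [h2] at h3
          have h6 := Prod.mk.inj h3
          have h7 := h5 r h6.1.symm
          rw [← h6.2] at h7
          exact (hFle r c).trans_lt h7
      · have h3 := hFoff (r + 1) c (by rwa [show r + 1 + c = r + c + 1 by omega])
        rw [h3] at hne ⊢
        exact (hFle r c).trans_lt (hG.col r c hne)
    · refine (hG.finite.union (Set.finite_singleton (r₀, c₀))).subset ?_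
      rintro ⟨r, c⟩ h
      by_cases h1 : r = r₀ ∧ c = c₀
      · exact Or.inr (by simp [h1])
      · exact Or.inl fun h2 => h ((hs r c).2 ⟨h2, h1⟩)
  have hpath : ∀ k, holePath F (0, 0) k = p k := by
    intro k
    induction k with
    | zero => exact hp0.symm
    | succ k ih =>
      simp only [holePath, ih]
      have hk := hsum k
      -- Only one neighbour of the hole lies on the path; the other still holds its entry of `G`, so
      -- the comparison made by the hole is a comparison within `G`.
      have hoff : ∀ r c, r + c = k + 1 → (r, c) ≠ p (k + 1) → F r c = G r c := by
        intro r c h h'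
        exact hFoff r c (by rw [h]; exact h'.symm)
      rcases hp k with ⟨h1, -⟩ | ⟨h1, h2, -⟩
      · rw [if_pos, h1]
        rw [hFstep _ _ k h1, hoff _ _ (by omega) (by rw [h1]; simp)]
        exact hG.row _ _
      · rw [if_neg, h1]
        rw [hFstep _ _ k h1, hoff _ _ (by omega) (by rw [h1]; simp), not_le]
        by_cases h3 : G ((p k).1 + 1) (p k).2 = ⊤
        · rw [h3]
          exact (hlt k h2).lt_top
        · exact hG.col _ _ h3
  refine ⟨F, hF, hF0, ?_, hs⟩
  funext r c
  have hon : ∀ r c, OnPath F r c ↔ p (r + c) = (r, c) := fun r c => by rw [OnPath, hpath]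
  by_cases h : p (r + c) = (r, c)
  · obtain ⟨s, d, h1, h2⟩ := exists_onPath F (r + c + 1)
    rw [slideFilling_step ((hon r c).2 h) h2 h1, hFstep s d (r + c) (h1 ▸ (hon s d).1 h2), h]
  · rw [slideFilling_of_not_onPath (mt (hon r c).1 h), hFoff r c h]

/-! ### The relative position of two consecutive letters -/

/-- The letter `y` lies in a row strictly below the row of `x`. -/
def StrictlyBelow (F : ℕ → ℕ → WithTop ℕ) (x y : ℕ) : Prop :=
  ∃ r c s d, F r c = (x : WithTop ℕ) ∧ F s d = (y : WithTop ℕ) ∧ r < s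

/-- The letter `y` lies in the row of `x` or in a row above it. -/
def WeaklyAbove (F : ℕ → ℕ → WithTop ℕ) (x y : ℕ) : Prop :=
  ∃ r c s d, F r c = (x : WithTop ℕ) ∧ F s d = (y : WithTop ℕ) ∧ s ≤ r

theorem eq_natCast_succ {a : WithTop ℕ} {x : ℕ} (h1 : (x : WithTop ℕ) < a)
    (h2 : a ≤ ((x + 1 : ℕ) : WithTop ℕ)) : a = ((x + 1 : ℕ) : WithTop ℕ) := by
  obtain ⟨n, rfl⟩ := exists_natCast_eq (ne_top_of_le_ne_top (by simp) h2)
  have h3 : x < n := by exact_mod_cast h1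
  have h4 : n ≤ x + 1 := by exact_mod_cast h2
  rw [show n = x + 1 by omega]

theorem eq_natCast {a : WithTop ℕ} {x : ℕ} (h1 : (x : WithTop ℕ) ≤ a)
    (h2 : a < ((x + 1 : ℕ) : WithTop ℕ)) : a = x := by
  obtain ⟨n, rfl⟩ := exists_natCast_eq h2.ne_top
  have h3 : x ≤ n := by exact_mod_cast h1
  have h4 : n < x + 1 := by exact_mod_cast h2
  rw [show n = x by omega]

theorem natCast_lt_succ (x : ℕ) : (x : WithTop ℕ) < ((x + 1 : ℕ) : WithTop ℕ) := by
  exact_mod_cast Nat.lt_succ_self x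

/-- No integer lies between `x` and `x + 1`, so a letter `x` entering the row of `x + 1` must bump
precisely `x + 1`. -/
theorem carried_succ_eq_of_consecutive {F : ℕ → ℕ → WithTop ℕ} (hF : IsFilling F) {x z r d : ℕ}
    (h1 : carried F z r = x) (h2 : F r d = ((x + 1 : ℕ) : WithTop ℕ)) :
    carried F z (r + 1) = ((x + 1 : ℕ) : WithTop ℕ) := by
  have hne : carried F z r ≠ ⊤ := by simp [h1]
  rw [carried_succ hne]
  refine eq_natCast_succ (h1 ▸ hF.lt_bumpColumn r hne) ?_
  rw [← h2]
  refine hF.monotone_row r (bumpColumn_le ?_)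
  rw [h1, h2]
  exact natCast_lt_succ x

/-- Letters stay or drop one row. The only danger is `x` dropping into the row of `x + 1`, but then
it bumps `x + 1` one row further. -/
theorem StrictlyBelow.insert {F : ℕ → ℕ → WithTop ℕ} (hF : IsFilling F) {x z : ℕ}
    (h : StrictlyBelow F x (x + 1)) : StrictlyBelow (insertFilling F z) x (x + 1) := by
  obtain ⟨r, c, s, d, hx, hy, hrs⟩ := h
  rcases insertFilling_entry (x := z) hx with hx1 | ⟨hc, c', hx1⟩ <;>
    rcases insertFilling_entry (x := z) hy with hy1 | ⟨-, d', hy1⟩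
  · exact ⟨_, _, _, _, hx1, hy1, hrs⟩
  · exact ⟨_, _, _, _, hx1, hy1, by omega⟩
  · rcases (Nat.succ_le_of_lt hrs).lt_or_eq with h1 | h1
    · exact ⟨_, _, _, _, hx1, hy1, h1⟩
    · have h2 := carried_succ_eq_of_consecutive hF hc (h1 ▸ hy)
      exact ⟨_, _, _, _, hx1, (insertFilling_bump (by simp [h2])).trans h2, Nat.lt_succ_self _⟩
  · exact ⟨_, _, _, _, hx1, hy1, by omega⟩

theorem strictlyBelow_insert {F : ℕ → ℕ → WithTop ℕ} (hF : IsFilling F) {x : ℕ}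
    (h : HasEntry F (x + 1)) : StrictlyBelow (insertFilling F x) x (x + 1) := by
  obtain ⟨s, d, hy⟩ := h
  have hx := insertFilling_bump (F := F) (x := x) (r := 0) (by simp [carried])
  rcases insertFilling_entry (x := x) hy with hy1 | ⟨-, d', hy1⟩
  · rcases Nat.eq_zero_or_pos s with rfl | hs
    · have h2 := carried_succ_eq_of_consecutive hF (z := x) rfl hy
      exact ⟨_, _, _, _, hx, (insertFilling_bump (by simp [h2])).trans h2, Nat.lt_succ_self _⟩
    · exact ⟨_, _, _, _, hx, hy1, hs⟩
  · exact ⟨_, _, _, _, hx, hy1, Nat.succ_pos _⟩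

/-- The only danger is that `x + 1` is bumped from a row shared with `x` while `x` stays. The
bumping letter would have to be `x` itself, neither newly inserted (`hz`) nor coming from the row
above, by distinctness. -/
theorem WeaklyAbove.insert {F : ℕ → ℕ → WithTop ℕ} (hF : IsFilling F) (hd : EntriesDistinct F)
    {x z : ℕ} (hz : z ≠ x) (h : WeaklyAbove F x (x + 1)) :
    WeaklyAbove (insertFilling F z) x (x + 1) := by
  obtain ⟨r, c, s, d, hx, hy, hrs⟩ := h
  rcases insertFilling_entry (x := z) hx with hx1 | ⟨-, c', hx1⟩ <;>
    rcases insertFilling_entry (x := z) hy with hy1 | ⟨hc, d', hy1⟩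
  · exact ⟨_, _, _, _, hx1, hy1, hrs⟩
  · rcases hrs.lt_or_eq with h1 | rfl
    · exact ⟨_, _, _, _, hx1, hy1, h1⟩
    · exfalso
      have hne : carried F z s ≠ ⊤ := carried_ne_top_of_succ (by simp [hc])
      have hcar : carried F z s = x := by
        have h1 := hF.lt_bumpColumn s hne
        rw [← carried_succ hne, hc] at h1
        have h2 : (x : WithTop ℕ) ≤ carried F z s := by
          by_contra h2
          have h3 := hF.monotone_row s (bumpColumn_le (hx.symm ▸ not_le.1 h2))
          rw [← carried_succ hne, hc, hx] at h3
          exact absurd (natCast_lt_succ x) (not_lt.2 h3)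
        exact eq_natCast h2 h1
      rcases carried_eq_entry hne with ⟨-, h1⟩ | ⟨t, h1, -, h2⟩
      · rw [hcar] at h1
        exact hz (by exact_mod_cast h1.symm)
      · have := (hd _ _ _ _ ((hx.trans hcar.symm).trans h2) (by simp [hx])).1
        omega
  · exact ⟨_, _, _, _, hx1, hy1, by omega⟩
  · exact ⟨_, _, _, _, hx1, hy1, by omega⟩

theorem weaklyAbove_insert {F : ℕ → ℕ → WithTop ℕ} {x : ℕ} (h : HasEntry F x) :
    WeaklyAbove (insertFilling F (x + 1)) x (x + 1) := by
  obtain ⟨r, c, hx⟩ := (hasEntry_insertFilling (x := x + 1)).2 (Or.inr h)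
  exact ⟨r, c, 0, _, hx, insertFilling_bump (by simp [carried]), Nat.zero_le _⟩

/-- Trouble could arise only if `x + 1` moved up into the row where `x` remains, either in place or
shifted left. The order of consecutive letters and the monotonicity of the hole's path exclude both.
-/
theorem StrictlyBelow.slide {F : ℕ → ℕ → WithTop ℕ} (hF : IsFilling F) (hd : EntriesDistinct F)
    {x : ℕ} (h0 : F 0 0 ≠ x) (h : StrictlyBelow F x (x + 1)) :
    StrictlyBelow (slideFilling F (0, 0)) x (x + 1) := by
  obtain ⟨r, c, s, d, hx, hy, hrs⟩ := h
  have hx0 : r + c ≠ 0 := fun h => by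
    obtain ⟨rfl, rfl⟩ : r = 0 ∧ c = 0 := by omega
    exact h0 hx
  -- The entry directly above `x + 1` is smaller than `x + 1` and, by the row order, at least `x`;
  -- hence it is `x`.
  have between : ∀ {c d}, F r c = x → F (r + 1) d = ((x + 1 : ℕ) : WithTop ℕ) → c ≤ d → c = d := by
    intro c d hx hy hcd
    have h1 : F r d < F (r + 1) d := hF.col r d (by simp [hy])
    have h2 := hF.mono (le_refl r) hcd
    rw [hx] at h2
    rw [hy] at h1
    exact (hd r c r d (hx.trans (eq_natCast h2 h1).symm) (by simp [hx])).2
  rcases slideFilling_entry (F := F) (r := s) (c := d) (by omega) with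
    ⟨hyp, hy1⟩ | ⟨s, rfl, hyp, hyle, hy1⟩ | ⟨d, rfl, hyp, hyle, hy1⟩ <;>
  rcases slideFilling_entry (F := F) hx0 with
    ⟨hxp, hx1⟩ | ⟨r, rfl, hxp, hxle, hx1⟩ | ⟨c, rfl, hxp, hxle, hx1⟩
  all_goals rw [hx] at hx1
  all_goals rw [hy] at hy1
  case inr.inl.inl =>
    rcases (Nat.lt_succ_iff.1 hrs).lt_or_eq with h1 | rfl
    · exact ⟨_, _, _, _, hx1, hy1, h1⟩
    · exfalso
      rcases le_or_gt c d with hcd | hcd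
      · obtain rfl := between hx hy hcd
        exact hxp hyp
      · have h3 := hyle.trans (hF.mono (le_refl r) (Nat.succ_le_of_lt hcd))
        rw [hx, hy] at h3
        exact absurd (natCast_lt_succ x) (not_lt.2 h3)
  case inr.inl.inr.inr =>
    rcases (Nat.lt_succ_iff.1 hrs).lt_or_eq with h1 | rfl
    · exact ⟨_, _, _, _, hx1, hy1, h1⟩
    · exfalso
      rcases le_or_gt (c + 1) d with hcd | hcd
      · obtain rfl := between hx hy hcd
        have h1 := hF.row (r + 1) c
        rw [hx] at hxle
        rw [hy] at h1
        have h2 := eq_natCast_succ hxle h1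
        have h3 := hd _ _ _ _ (h2.trans hy.symm) (by simp [h2])
        omega
      -- Both old places lie on the path, yet the one further down lies on an antidiagonal that is
      -- not later: the hole would have to move up.
      · have h1 := (hyp.down hyle).mono (hxp.right hxle) (by omega)
        omega
  all_goals exact ⟨_, _, _, _, hx1, hy1, by omega⟩

/-- The only danger is `x` moving up out of a row that it shares with `x + 1`. The rival entry to
the right of the hole would be at least `x` and below `x + 1`, a second copy of `x`. -/
theorem WeaklyAbove.slide {F : ℕ → ℕ → WithTop ℕ} (hF : IsFilling F) (hd : EntriesDistinct F)
    {x : ℕ} (h0 : F 0 0 < x) (h : WeaklyAbove F x (x + 1)) :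
    WeaklyAbove (slideFilling F (0, 0)) x (x + 1) := by
  obtain ⟨r, c, s, d, hx, hy, hrs⟩ := h
  have hx0 : r + c ≠ 0 := fun h => by
    obtain ⟨rfl, rfl⟩ : r = 0 ∧ c = 0 := by omega
    exact h0.ne hx
  have hy0 : s + d ≠ 0 := fun h => by
    obtain ⟨rfl, rfl⟩ : s = 0 ∧ d = 0 := by omega
    exact (h0.trans (natCast_lt_succ x)).ne hy
  have stay : ∀ {r d}, F (r + 1) c = x → F (r + 1) d = ((x + 1 : ℕ) : WithTop ℕ) →
      F (r + 1) c ≤ F r (c + 1) → False := by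
    intro r d hx hy hle
    have hcd : c < d := by
      by_contra hcd
      have h1 := hF.mono (le_refl (r + 1)) (not_lt.1 hcd)
      rw [hx, hy] at h1
      exact absurd (natCast_lt_succ x) (not_lt.2 h1)
    have h1 := hF.mono (le_refl (r + 1)) (Nat.succ_le_of_lt hcd)
    rw [hy] at h1
    have h2 := (hF.col r (c + 1) (ne_top_of_le_ne_top (by simp) h1)).trans_le h1
    rw [hx] at hle
    have h3 := eq_natCast hle h2
    have := hd _ _ _ _ (hx.trans h3.symm) (by simp [hx])
    omega
  rcases slideFilling_entry (F := F) hy0 with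
    ⟨hyp, hy1⟩ | ⟨s, rfl, hyp, hyle, hy1⟩ | ⟨d, rfl, hyp, hyle, hy1⟩ <;>
  rcases slideFilling_entry (F := F) hx0 with
    ⟨hxp, hx1⟩ | ⟨r, rfl, hxp, hxle, hx1⟩ | ⟨c, rfl, hxp, hxle, hx1⟩
  all_goals rw [hx] at hx1
  all_goals rw [hy] at hy1
  case inl.inr.inl | inr.inr.inr.inl =>
    rcases hrs.lt_or_eq with h1 | rfl
    · exact ⟨_, _, _, _, hx1, hy1, by omega⟩
    · exact (stay hx hy hxle).elim
  all_goals exact ⟨_, _, _, _, hx1, hy1, by omega⟩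

/-! ### Two successive slides -/

theorem StrictlyBelow.next_le {F : ℕ → ℕ → WithTop ℕ} (hF : IsFilling F) {x : ℕ}
    (h0 : F 0 0 = x) (h : StrictlyBelow F x (x + 1)) (hd : EntriesDistinct F) :
    F 1 0 ≤ F 0 1 := by
  obtain ⟨r, c, s, d, hx, hy, hrs⟩ := h
  have h1 := hF.mono (Nat.succ_le_of_lt (Nat.zero_lt_of_lt hrs)) (Nat.zero_le d)
  rw [hy] at h1
  have h2 : F 0 0 ≤ F 0 1 := hF.row 0 0
  have h3 : F 0 0 ≠ F 0 1 := fun h => by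
    have := hd _ _ _ _ h (by simp [h0])
    omega
  have h4 := lt_of_le_of_ne h2 h3
  rw [h0] at h4
  by_contra h5
  have h6 := (not_le.1 h5).trans_le h1
  rw [eq_natCast h4.le h6] at h4
  exact lt_irrefl _ h4

theorem WeaklyAbove.next_lt {F : ℕ → ℕ → WithTop ℕ} (hF : IsFilling F) {x : ℕ}
    (h0 : F 0 0 = x) (h : WeaklyAbove F x (x + 1)) (hd : EntriesDistinct F) :
    F 0 1 < F 1 0 := by
  obtain ⟨r, c, s, d, hx, hy, hrs⟩ := h
  obtain ⟨rfl, rfl⟩ := hd _ _ _ _ (hx.trans h0.symm) (by simp [hx])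
  obtain rfl : s = 0 := by omega
  have hd0 : d ≠ 0 := by
    rintro rfl
    rw [h0] at hy
    exact absurd hy (natCast_lt_succ x).ne
  have h1 := hF.mono (le_refl 0) (Nat.one_le_iff_ne_zero.2 hd0)
  rw [hy] at h1
  by_contra h2
  have h3 := (not_lt.1 h2).trans h1
  have h4 : F 0 0 < F 1 0 := hF.col 0 0 (ne_top_of_le_ne_top (by simp) h3)
  rw [h0] at h4
  have h5 := hd _ _ _ _ ((eq_natCast_succ h4 h3).trans hy.symm) (ne_top_of_le_ne_top (by simp) h3)
  omega

/-- If the first hole starts downwards, then the second hole stays above its path. -/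
theorem OnPath.second_above {F : ℕ → ℕ → WithTop ℕ} (hF : IsFilling F) (h0 : F 1 0 ≤ F 0 1)
    {r c s d : ℕ} (h1 : OnPath F r c) (h2 : OnPath (slideFilling F (0, 0)) s d)
    (h : r + c = s + d) : s < r ∨ (s = r ∧ OnPath F (r + 1) c) := by
  obtain ⟨k, hk⟩ : ∃ k, r + c = k := ⟨_, rfl⟩
  induction k generalizing r c s d with
  | zero =>
    obtain ⟨rfl, rfl⟩ : r = 0 ∧ c = 0 := by omega
    exact Or.inr ⟨by omega, h1.down h0⟩
  | succ k ih =>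
    have off : ∀ {r c a b}, OnPath F r c → r + c = a + b → r ≠ a →
        slideFilling F (0, 0) a b = F a b := fun h3 h4 h5 =>
      slideFilling_of_not_onPath fun h6 => h5 (h3.unique h6 h4).1
    rcases h1.pred (by omega) with ⟨r, rfl, h3, h3'⟩ | ⟨c, rfl, h3, h3'⟩ <;>
      rcases h2.pred (by omega) with ⟨s, rfl, h4, h4'⟩ | ⟨d, rfl, h4, h4'⟩
    · rcases ih h3 h4 (by omega) (by omega) with h5 | ⟨rfl, -⟩
      · left; omega
      · obtain rfl : c = d := by omega
        refine Or.inr ⟨rfl, h1.down ?_⟩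
        -- If the first hole turned right here, its slide brought the right neighbour into this box.
        -- The second hole then preferred that entry to the one originally directly above it,
        -- against strict columns.
        by_contra h6
        rw [slideFilling_step h1 (h1.right (not_le.1 h6)) (by omega),
          off h1 (by omega) (by omega)] at h4'
        exact absurd h4' (not_le.2 (hF.col _ _ (not_le.1 h6).ne_top))
    · rcases ih h3 h4 (by omega) (by omega) with h5 | ⟨rfl, -⟩ <;> left <;> omega
    · rcases ih h3 h4 (by omega) (by omega) with h5 | ⟨rfl, h5⟩
      · rcases (Nat.succ_le_of_lt h5).lt_or_eq with h6 | h6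
        · exact Or.inl h6
        · subst h6
          obtain rfl : c + 1 = d := by omega
          refine Or.inr ⟨rfl, h1.down ?_⟩
          by_contra h6
          rw [slideFilling_step h1 (h1.right (not_le.1 h6)) (by omega),
            off h1 (by omega) (by omega)] at h4'
          exact absurd h4' (not_le.2 (hF.col _ _ (not_le.1 h6).ne_top))
      · have := h5.unique h1 (by omega)
        omega
    · rcases ih h3 h4 (by omega) (by omega) with h5 | ⟨rfl, h5⟩
      · exact Or.inl h5
      · have := h5.unique h1 (by omega)
        omega

/-- If the first hole starts to the right, then the second hole stays below its path. -/
theorem OnPath.second_below {F : ℕ → ℕ → WithTop ℕ} (hF : IsFilling F) (h0 : F 0 1 < F 1 0)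
    {r c s d : ℕ} (h1 : OnPath F r c) (h2 : OnPath (slideFilling F (0, 0)) s d)
    (h : r + c = s + d) : r < s ∨ (s = r ∧ OnPath F r (c + 1)) := by
  obtain ⟨k, hk⟩ : ∃ k, r + c = k := ⟨_, rfl⟩
  induction k generalizing r c s d with
  | zero =>
    obtain ⟨rfl, rfl⟩ : r = 0 ∧ c = 0 := by omega
    exact Or.inr ⟨by omega, h1.right h0⟩
  | succ k ih =>
    have off : ∀ {r c a b}, OnPath F r c → r + c = a + b → r ≠ a →
        slideFilling F (0, 0) a b = F a b := fun h3 h4 h5 =>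
      slideFilling_of_not_onPath fun h6 => h5 (h3.unique h6 h4).1
    rcases h1.pred (by omega) with ⟨r, rfl, h3, h3'⟩ | ⟨c, rfl, h3, h3'⟩ <;>
      rcases h2.pred (by omega) with ⟨s, rfl, h4, h4'⟩ | ⟨d, rfl, h4, h4'⟩
    · rcases ih h3 h4 (by omega) (by omega) with h5 | ⟨rfl, h5⟩
      · left; omega
      · have := h5.unique h1 (by omega)
        omega
    · rcases ih h3 h4 (by omega) (by omega) with h5 | ⟨rfl, h5⟩
      · rcases (Nat.succ_le_of_lt h5).lt_or_eq with h6 | h6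
        · exact Or.inl h6
        · subst h6
          obtain rfl : c = d + 1 := by omega
          refine Or.inr ⟨rfl, h1.right ?_⟩
          -- If the first hole turned down here, its slide brought the lower neighbour into this
          -- box. The second hole then found that entry strictly smaller than its left neighbour,
          -- against weak rows.
          by_contra h6
          rw [slideFilling_step h1 (h1.down (not_lt.1 h6)) (by omega),
            off h1 (by omega) (by omega)] at h4'
          exact absurd h4' (not_lt.2 (hF.row _ _))
      · have := h5.unique h1 (by omega)
        omega
    · rcases ih h3 h4 (by omega) (by omega) with h5 | ⟨rfl, -⟩ <;> left <;> omega
    · rcases ih h3 h4 (by omega) (by omega) with h5 | ⟨rfl, -⟩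
      · exact Or.inl h5
      · obtain rfl : c = d := by omega
        refine Or.inr ⟨rfl, h1.right ?_⟩
        by_contra h6
        rw [slideFilling_step h1 (h1.down (not_lt.1 h6)) (by omega),
          off h1 (by omega) (by omega)] at h4'
        exact absurd h4' (not_lt.2 (hF.row _ _))

/-- Otherwise the second path would end weakly below and strictly left of the first one's last box,
on the wrong side of the first path. -/
theorem second_lastBox_lt {F : ℕ → ℕ → WithTop ℕ} (hF : IsFilling F) (h0 : F 1 0 ≤ F 0 1)
    {R C R' C' : ℕ} (hp : OnPath F R C) (h1 : F (R + 1) C = ⊤) (h2 : F R (C + 1) = ⊤)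
    (hp' : OnPath (slideFilling F (0, 0)) R' C') (hne : F R' C' ≠ ⊤)
    (hRC : ¬ (R' = R ∧ C' = C)) : R' < R := by
  by_contra hR
  have hC : C' < C := by
    by_contra hC
    rcases (not_lt.1 hR).lt_or_eq with h3 | h3
    · exact hne (top_le_iff.1 (h1 ▸ hF.mono h3 (not_lt.1 hC)))
    · exact hne (top_le_iff.1 (h2 ▸ hF.mono h3.le (by omega : C + 1 ≤ C')))
  obtain ⟨r, c, hrc, hq⟩ := exists_onPath F (R' + C')
  have hle : R' < r ∨ (R' = r ∧ OnPath F (r + 1) c) := hq.second_above hF h0 hp' hrc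
  rcases le_total (r + c) (R + C) with h3 | h3
  · have h4 := hq.mono hp h3
    rcases hle with h5 | ⟨rfl, h5⟩
    · omega
    · have := h5.mono hp (by omega)
      omega
  · have h4 := hp.mono hq h3
    omega

/-- Otherwise the second path would end strictly above and weakly right of the first one's last box,
again on the wrong side. `htop` says that no box remains below the second last box after the first
removal. -/
theorem second_lastBox_ge {F : ℕ → ℕ → WithTop ℕ} (hF : IsFilling F) (h0 : F 0 1 < F 1 0)
    {R C R' C' : ℕ} (hp : OnPath F R C) (hne : F R C ≠ ⊤)
    (hp' : OnPath (slideFilling F (0, 0)) R' C')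
    (htop : F (R' + 1) C' = ⊤ ∨ (R' + 1 = R ∧ C' = C)) : R ≤ R' := by
  by_contra hR
  have hC : C ≤ C' := by
    by_contra hC
    rcases htop with h | h
    · exact hne (top_le_iff.1 (h ▸ hF.mono (by omega) (by omega)))
    · omega
  obtain ⟨r, c, hrc, hq⟩ := exists_onPath F (R' + C')
  have hle : r < R' ∨ (R' = r ∧ OnPath F r (c + 1)) := hq.second_below hF h0 hp' hrc
  rcases le_total (R + C) (r + c) with h3 | h3
  · have h4 := hp.mono hq h3
    omega
  · have h4 := hq.mono hp h3
    rcases hle with h5 | ⟨rfl, h5⟩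
    · omega
    · have := h5.mono hp (by omega)
      omega

/-! ### Chains of diagrams -/

theorem addsBox_iff {μ ν : YoungDiagram} :
    AddsBox μ ν ↔ ∃ r c, (r, c) ∉ μ ∧ ∀ s d, (s, d) ∈ ν ↔ (s, d) ∈ μ ∨ (s = r ∧ d = c) := by
  constructor
  · rintro ⟨hle, hcard⟩
    have hsub : μ.cells ⊆ ν.cells := hle
    have h1 : (ν.cells \ μ.cells).card = 1 := by
      rw [Finset.card_sdiff_of_subset hsub]
      simp only [YoungDiagram.card] at hcard
      omega
    obtain ⟨⟨r, c⟩, hp⟩ := Finset.card_eq_one.1 h1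
    have h2 : ∀ s d, ((s, d) ∈ ν ∧ (s, d) ∉ μ) ↔ (s = r ∧ d = c) := by
      intro s d
      have := congrArg ((s, d) ∈ ·) hp
      simpa using this
    refine ⟨r, c, ((h2 r c).2 ⟨rfl, rfl⟩).2, fun s d => ?_⟩
    have h3 := h2 s d
    have h4 : (s, d) ∈ μ → (s, d) ∈ ν := fun h => hle h
    tauto
  · rintro ⟨r, c, h1, h2⟩
    have h3 : ν.cells = insert (r, c) μ.cells := by
      ext ⟨s, d⟩
      simp [h2, or_comm]
    refine ⟨fun x hx => (h2 x.1 x.2).2 (Or.inl hx), ?_⟩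
    rw [YoungDiagram.card, h3, Finset.card_insert_of_notMem (by simpa using h1)]

/-- In the chain `μ ⊆ ν ⊆ ρ`, the second box is added strictly below the first one. -/
def DescentChain (μ ν ρ : YoungDiagram) : Prop :=
  ∃ r c s d, (r, c) ∈ ν ∧ (r, c) ∉ μ ∧ (s, d) ∈ ρ ∧ (s, d) ∉ ν ∧ r < s

theorem descentChain_iff {μ ν ρ : YoungDiagram} {r c s d : ℕ} (h1 : (r, c) ∉ μ)
    (h2 : ∀ a b, (a, b) ∈ ν ↔ (a, b) ∈ μ ∨ (a = r ∧ b = c)) (h3 : (s, d) ∉ ν)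
    (h4 : ∀ a b, (a, b) ∈ ρ ↔ (a, b) ∈ ν ∨ (a = s ∧ b = d)) :
    DescentChain μ ν ρ ↔ r < s := by
  constructor
  · rintro ⟨r', c', s', d', g1, g2, g3, g4, g5⟩
    have e1 := ((h2 r' c').1 g1).resolve_left g2
    have e2 := ((h4 s' d').1 g3).resolve_left g4
    omega
  · exact fun h => ⟨r, c, s, d, (h2 r c).2 (Or.inr ⟨rfl, rfl⟩), h1,
      (h4 s d).2 (Or.inr ⟨rfl, rfl⟩), h3, h⟩

/-- Of two boxes added in succession, the second is neither strictly below and strictly right of the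
first (a box between would be missing) nor weakly above and weakly left of it (it would already be
present). So "strictly below" and "strictly to the right" are complementary. -/
theorem descentChain_transpose {μ ν ρ : YoungDiagram} (h1 : AddsBox μ ν) (h2 : AddsBox ν ρ) :
    DescentChain μ.transpose ν.transpose ρ.transpose ↔ ¬ DescentChain μ ν ρ := by
  obtain ⟨r, c, h3, h4⟩ := addsBox_iff.1 h1
  obtain ⟨s, d, h5, h6⟩ := addsBox_iff.1 h2
  rw [descentChain_iff h3 h4 h5 h6, descentChain_iff (r := c) (c := r) (s := d) (d := s)
    (by simpa [YoungDiagram.mem_transpose] using h3)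
    (fun a b => by simp [YoungDiagram.mem_transpose, h4, and_comm])
    (by simpa [YoungDiagram.mem_transpose] using h5)
    (fun a b => by simp [YoungDiagram.mem_transpose, h6, and_comm])]
  constructor
  · intro h7 h8
    have h9 : (s, c) ∈ ρ := ρ.up_left_mem le_rfl h7.le ((h6 s d).2 (Or.inr ⟨rfl, rfl⟩))
    have h10 := ((h6 s c).1 h9).resolve_right (by omega)
    have h11 := ((h4 s c).1 h10).resolve_right (by omega)
    exact h3 (μ.up_left_mem h8.le le_rfl h11)
  · intro h7
    by_contra h8
    exact h5 (ν.up_left_mem (not_lt.1 h7) (not_lt.1 h8) ((h4 r c).2 (Or.inr ⟨rfl, rfl⟩)))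

/-! ### Distinctness and reverse steps -/

theorem insertFilling_target {F : ℕ → ℕ → WithTop ℕ} {x r c : ℕ} (h : F r c ≠ ⊤) :
    ∃ s d, insertFilling F x s d = F r c ∧
      ((¬ (carried F x r ≠ ⊤ ∧ c = bumpColumn F r (carried F x r)) ∧ s = r ∧ d = c) ∨
        ((carried F x r ≠ ⊤ ∧ c = bumpColumn F r (carried F x r)) ∧ s = r + 1 ∧
          carried F x s ≠ ⊤ ∧ d = bumpColumn F s (carried F x s))) := by
  by_cases h1 : carried F x r ≠ ⊤ ∧ c = bumpColumn F r (carried F x r)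
  · have h2 : carried F x (r + 1) = F r c := by rw [carried_succ h1.1, ← h1.2]
    exact ⟨r + 1, _, (insertFilling_bump (h2 ▸ h)).trans h2, Or.inr ⟨h1, rfl, h2 ▸ h, rfl⟩⟩
  · exact ⟨r, c, insertFilling_of_not h1, Or.inl ⟨h1, rfl, rfl⟩⟩

/-- Insertion carries old entries injectively to new places with the same values, and none of them
to the place of `x` in row 0. This passes distinctness backwards through a reverse insertion. -/
theorem EntriesDistinct.of_insert {F : ℕ → ℕ → WithTop ℕ} {x : ℕ}
    (hd : EntriesDistinct (insertFilling F x)) : EntriesDistinct F ∧ ¬ HasEntry F x := by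
  constructor
  · intro r c r' c' h hne
    obtain ⟨s, d, h1, h2⟩ := insertFilling_target (x := x) hne
    obtain ⟨s', d', h1', h2'⟩ := insertFilling_target (x := x) (h ▸ hne)
    obtain ⟨rfl, rfl⟩ := hd s d s' d' (by rw [h1, h1', h]) (h1 ▸ hne)
    rcases h2 with ⟨h2, rfl, rfl⟩ | ⟨h2, h3, h4⟩ <;>
      rcases h2' with ⟨h2', h3', h4'⟩ | ⟨h2', h3', h4'⟩
    · exact ⟨h3', h4'⟩
    · exact absurd h4' h2
    · subst h3' h4'
      exact absurd h4 h2'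
    · obtain rfl : r = r' := by omega
      exact ⟨rfl, h2.2.trans h2'.2.symm⟩
  · rintro ⟨r, c, h⟩
    obtain ⟨s, d, h1, h2⟩ := insertFilling_target (x := x) (F := F) (r := r) (c := c) (by simp [h])
    have h0 := insertFilling_bump (F := F) (x := x) (r := 0) (by simp [carried])
    obtain ⟨rfl, rfl⟩ := hd s d 0 _ ((h1.trans h).trans h0.symm) (by simp [h1, h])
    rcases h2 with ⟨h2, rfl, rfl⟩ | ⟨-, h3, -⟩
    · exact h2 ⟨by simp [carried], rfl⟩
    · omega

theorem slideFilling_target {F : ℕ → ℕ → WithTop ℕ} {r c : ℕ} (h0 : r + c ≠ 0) :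
    ∃ s d, slideFilling F (0, 0) s d = F r c ∧
      ((¬ OnPath F r c ∧ s = r ∧ d = c) ∨
        (OnPath F r c ∧ OnPath F s d ∧ r + c = s + d + 1)) := by
  by_cases h : OnPath F r c
  · obtain ⟨s, d, h1, h2⟩ := exists_onPath F (r + c - 1)
    exact ⟨s, d, slideFilling_step h2 h (by omega), Or.inr ⟨h, h2, by omega⟩⟩
  · exact ⟨r, c, slideFilling_of_not_onPath h, Or.inl ⟨h, rfl, rfl⟩⟩

/-- The slide loses only the corner entry. Distinctness elsewhere pulls back along the movement of
the entries, and `h0` separates the corner from them. -/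
theorem EntriesDistinct.of_slide {F : ℕ → ℕ → WithTop ℕ}
    (hd : EntriesDistinct (slideFilling F (0, 0)))
    (h0 : ∀ r c, F 0 0 < slideFilling F (0, 0) r c) : EntriesDistinct F := by
  have corner : ∀ r c, r + c ≠ 0 → F 0 0 ≠ F r c := by
    intro r c h h'
    obtain ⟨s, d, h1, -⟩ := slideFilling_target (F := F) h
    exact (h0 s d).ne (h'.trans h1.symm)
  intro r c r' c' h hne
  by_cases h1 : r + c = 0 <;> by_cases h2 : r' + c' = 0
  · omega
  · obtain ⟨rfl, rfl⟩ : r = 0 ∧ c = 0 := by omega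
    exact absurd h (corner _ _ h2)
  · obtain ⟨rfl, rfl⟩ : r' = 0 ∧ c' = 0 := by omega
    exact absurd h.symm (corner _ _ h1)
  · obtain ⟨s, d, h3, h4⟩ := slideFilling_target (F := F) h1
    obtain ⟨s', d', h3', h4'⟩ := slideFilling_target (F := F) h2
    obtain ⟨rfl, rfl⟩ := hd s d s' d' (by rw [h3, h3', h]) (h3 ▸ hne)
    rcases h4 with ⟨h4, rfl, rfl⟩ | ⟨h4, h5, h6⟩ <;>
      rcases h4' with ⟨h4', h5', h6'⟩ | ⟨h4', h5', h6'⟩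
    · exact ⟨h5', h6'⟩
    · exact absurd h5' h4
    · subst h5' h6'
      exact absurd h5 h4'
    · exact h4.unique h4' (by omega)

/-! ### The tableaux of a matching -/

theorem Tableau.mem_iff_box {P : Tableau} {r c : ℕ} : (r, c) ∈ P.1 ↔ P.box r c ≠ ⊤ := by
  unfold Tableau.box
  split_ifs with h <;> simp [h]

theorem Tableau.box_empty : Tableau.empty.box = fun _ _ => ⊤ := by
  funext r c
  exact if_neg (YoungDiagram.notMem_bot _)

theorem Tableau.box_rowInsert (P : Tableau) (x : ℕ) :
    (P.rowInsert x).box = insertFilling P.box x :=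
  Tableau.box_ofFilling _ _

theorem Tableau.box_removeEntry {P : Tableau} {x : ℕ} (hd : EntriesDistinct P.box)
    (h0 : P.box 0 0 = x) : (P.removeEntry x).box = slideFilling P.box (0, 0) := by
  have h : ∃ p : ℕ × ℕ, P.box p.1 p.2 = x := ⟨(0, 0), h0⟩
  have h1 : h.choose = (0, 0) := by
    have h2 := hd _ _ _ _ (h.choose_spec.trans h0.symm) (by simp [h.choose_spec])
    exact Prod.ext h2.1 h2.2
  rw [Tableau.removeEntry, dif_pos h, Tableau.box_ofFilling, h1]

theorem IsFilling.corner_eq {F : ℕ → ℕ → WithTop ℕ} (hF : IsFilling F) {x : ℕ}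
    (h : HasEntry F x) (hmin : ∀ v, HasEntry F v → x ≤ v) : F 0 0 = x := by
  obtain ⟨r, c, h1⟩ := h
  have h2 := hF.mono (Nat.zero_le r) (Nat.zero_le c)
  rw [h1] at h2
  obtain ⟨v, hv⟩ := exists_natCast_eq (ne_top_of_le_ne_top (by simp) h2)
  refine le_antisymm h2 ?_
  rw [← hv]
  exact_mod_cast hmin v ⟨0, 0, hv.symm⟩

theorem Matching.apply_apply {n : ℕ} (π : Matching n) (i : Fin (2 * n)) : π.1 (π.1 i) = i := by
  have := congrArg (fun σ : Equiv.Perm (Fin (2 * n)) => σ i) π.2.1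
  simpa [pow_two] using this

theorem Matching.val_ne {n : ℕ} (π : Matching n) (i : Fin (2 * n)) : (π.1 i).val ≠ i.val :=
  fun h => π.2.2 i (Fin.ext h)

theorem tableauSeq_open {n : ℕ} (π : Matching n) (i : Fin (2 * n)) (h : i < π.1 i) :
    (tableauSeq π (i + 1)).box =
      insertFilling (tableauSeq π i).box ((π.1 i).val + 1) := by
  rw [tableauSeq, dif_pos i.2, if_pos (Fin.lt_def.1 h), Tableau.box_rowInsert]

/-- The letters present are the closing partners of the blocks currently open. In particular they
exceed `a`, so a letter about to be removed is the minimum and every slide starts in the corner. -/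
theorem tableauSeq_entries {n : ℕ} (π : Matching n) (a : ℕ) (ha : a ≤ 2 * n) :
    EntriesDistinct (tableauSeq π a).box ∧ ∀ v, HasEntry (tableauSeq π a).box v ↔
      ∃ j : Fin (2 * n), v = j.val + 1 ∧ a ≤ j.val ∧ (π.1 j).val < a := by
  induction a with
  | zero =>
    simp only [tableauSeq, Tableau.box_empty]
    exact ⟨fun r c s d _ h => absurd rfl h, fun v => by simp [HasEntry]⟩
  | succ a ih =>
    obtain ⟨hd, he⟩ := ih (by omega)
    set i : Fin (2 * n) := ⟨a, ha⟩ with hi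
    have hne := π.val_ne i
    have hpi : ∀ j, (π.1 j).val = a → j = π.1 i := fun j hj => by
      rw [← π.apply_apply j]
      exact congrArg π.1 (Fin.ext hj)
    by_cases h : i < π.1 i
    · have h' : a < (π.1 i).val := h
      rw [show a + 1 = i.val + 1 from rfl, tableauSeq_open π i h]
      refine ⟨hd.insert (Tableau.isFilling_box _) fun hx => ?_, fun v => ?_⟩
      · obtain ⟨j, h1, -, h2⟩ := (he _).1 hx
        obtain rfl : π.1 i = j := Fin.ext (by omega)
        rw [π.apply_apply] at h2
        exact lt_irrefl a h2
      · rw [hasEntry_insertFilling, he]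
        constructor
        · rintro (rfl | ⟨j, h1, h2, h3⟩)
          · exact ⟨π.1 i, rfl, h, by rw [π.apply_apply]; exact Nat.lt_succ_self a⟩
          · refine ⟨j, h1, lt_of_le_of_ne h2 fun h4 => ?_, by change _ < a + 1; omega⟩
            obtain rfl : i = j := Fin.ext h4
            omega
        · rintro ⟨j, h1, h2, h3⟩
          rcases (Nat.lt_succ_iff.1 h3).lt_or_eq with h4 | h4
          · exact Or.inr ⟨j, h1, by change a + 1 ≤ _ at h2; omega, h4⟩
          · left
            rw [h1, hpi j h4]
    · have h' : (π.1 i).val < a := lt_of_le_of_ne (not_lt.1 h) hne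
      have h0 : (tableauSeq π a).box 0 0 = ((a + 1 : ℕ) : WithTop ℕ) := by
        refine (Tableau.isFilling_box _).corner_eq ((he _).2 ⟨i, rfl, le_rfl, h'⟩) fun v hv => ?_
        obtain ⟨j, h1, h2, -⟩ := (he v).1 hv
        omega
      have hstep : (tableauSeq π (a + 1)).box = slideFilling (tableauSeq π a).box (0, 0) := by
        rw [tableauSeq, dif_pos (Nat.lt_of_succ_le ha), if_neg (mt Fin.lt_def.2 h),
          Tableau.box_removeEntry hd h0]
      rw [hstep]
      refine ⟨hd.slide, fun v => ?_⟩
      rw [hasEntry_slideFilling hd, he, h0]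
      constructor
      · rintro ⟨⟨j, h1, h2, h3⟩, h4⟩
        refine ⟨j, h1, lt_of_le_of_ne h2 fun h5 => h4 ?_, by omega⟩
        rw [h1, h5]
      · rintro ⟨j, h1, h2, h3⟩
        refine ⟨⟨j, h1, by omega, lt_of_le_of_ne (by omega) fun h4 => ?_⟩, fun h4 => ?_⟩
        · rw [hpi j h4] at h2
          omega
        · have : a + 1 = v := by exact_mod_cast h4
          omega

theorem tableauSeq_corner {n : ℕ} (π : Matching n) (i : Fin (2 * n)) (h : π.1 i < i) :
    (tableauSeq π i).box 0 0 = ((i.val + 1 : ℕ) : WithTop ℕ) := by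
  obtain ⟨-, he⟩ := tableauSeq_entries π i i.2.le
  refine (Tableau.isFilling_box _).corner_eq ((he _).2 ⟨i, rfl, le_rfl, h⟩) fun v hv => ?_
  obtain ⟨j, h1, h2, -⟩ := (he v).1 hv
  omega

theorem tableauSeq_close {n : ℕ} (π : Matching n) (i : Fin (2 * n)) (h : π.1 i < i) :
    (tableauSeq π (i + 1)).box = slideFilling (tableauSeq π i).box (0, 0) := by
  rw [tableauSeq, dif_pos i.2, if_neg (mt Fin.lt_def.2 h.not_gt),
    Tableau.box_removeEntry
    (tableauSeq_entries π i i.2.le).1 (tableauSeq_corner π i h)]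

theorem tableauSeq_last {n : ℕ} (π : Matching n) : (tableauSeq π (2 * n)).box = fun _ _ => ⊤ := by
  funext r c
  by_contra h
  obtain ⟨v, hv⟩ := exists_natCast_eq h
  obtain ⟨j, -, h1, -⟩ := ((tableauSeq_entries π _ le_rfl).2 v).1 ⟨r, c, hv.symm⟩
  have := j.2
  omega

theorem diagram_ext {μ ν : YoungDiagram} (h : ∀ r c, (r, c) ∈ μ ↔ (r, c) ∈ ν) : μ = ν := by
  ext ⟨r, c⟩
  exact h r c

/-- The box that an opening letter adds to the diagram. -/
theorem tableauSeq_open_box {n : ℕ} (π : Matching n) (i : Fin (2 * n)) (h : i < π.1 i) :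
    ∃ R k, (∀ r, carried (tableauSeq π i).box ((π.1 i).val + 1) r ≠ ⊤ ↔ r ≤ R) ∧
      (R, k) ∉ (tableauSeq π i).1 ∧
      ∀ s d, (s, d) ∈ (tableauSeq π (i + 1)).1 ↔ (s, d) ∈ (tableauSeq π i).1 ∨ (s = R ∧ d = k) := by
  obtain ⟨R, k, h1, h2, h3⟩ :=
    (Tableau.isFilling_box (tableauSeq π i)).exists_lastRow ((π.1 i).val + 1)
  refine ⟨R, k, h1, fun h4 => Tableau.mem_iff_box.1 h4 h2, fun s d => ?_⟩
  rw [Tableau.mem_iff_box, Tableau.mem_iff_box, tableauSeq_open π i h, h3]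

/-- The box that a closing letter removes from the diagram. -/
theorem tableauSeq_close_box {n : ℕ} (π : Matching n) (i : Fin (2 * n)) (h : π.1 i < i) :
    ∃ R C, OnPath (tableauSeq π i).box R C ∧ (tableauSeq π i).box (R + 1) C = ⊤ ∧
      (tableauSeq π i).box R (C + 1) = ⊤ ∧ (R, C) ∉ (tableauSeq π (i + 1)).1 ∧
      ∀ s d, (s, d) ∈ (tableauSeq π i).1 ↔ (s, d) ∈ (tableauSeq π (i + 1)).1 ∨ (s = R ∧ d = C) := by
  have hF := Tableau.isFilling_box (tableauSeq π i)
  obtain ⟨R, C, h1, h2, h3, h4⟩ :=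
    hF.exists_lastBox (by rw [tableauSeq_corner π i h]; simp)
  have h5 := slideFilling_ne_top_iff hF h1 h2 h3 h4
  rw [← tableauSeq_close π i h] at h5
  refine ⟨R, C, h1, h3, h4, fun h6 => ((h5 R C).1 (Tableau.mem_iff_box.1 h6)).2 ⟨rfl, rfl⟩,
    fun s d => ?_⟩
  rw [Tableau.mem_iff_box, Tableau.mem_iff_box, h5]
  by_cases h6 : s = R ∧ d = C
  · simp [h6, h2]
  · simp [h6]

theorem addsBox_of_open {n : ℕ} (π : Matching n) (i : Fin (2 * n)) (h : i < π.1 i) :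
    AddsBox (tableauSeq π i).1 (tableauSeq π (i + 1)).1 := by
  obtain ⟨R, k, -, h1, h2⟩ := tableauSeq_open_box π i h
  exact addsBox_iff.2 ⟨R, k, h1, h2⟩

theorem addsBox_of_close {n : ℕ} (π : Matching n) (i : Fin (2 * n)) (h : π.1 i < i) :
    AddsBox (tableauSeq π (i + 1)).1 (tableauSeq π i).1 := by
  obtain ⟨R, C, -, -, -, h1, h2⟩ := tableauSeq_close_box π i h
  exact addsBox_iff.2 ⟨R, C, h1, h2⟩

theorem AddsBox.not_symm {μ ν : YoungDiagram} (h : AddsBox μ ν) : ¬ AddsBox ν μ := by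
  intro h'
  have h1 := h.2
  have h2 := h'.2
  omega

theorem open_iff_addsBox {n : ℕ} (π : Matching n) (i : Fin (2 * n)) :
    i < π.1 i ↔ AddsBox (tableauSeq π i).1 (tableauSeq π (i + 1)).1 := by
  refine ⟨addsBox_of_open π i, fun h => ?_⟩
  by_contra h1
  exact h.not_symm (addsBox_of_close π i (lt_of_le_of_ne (not_lt.1 h1) (π.2.2 i)))

/-! ### Injectivity -/

theorem tableauSeq_step_injective {n : ℕ} {π π' : Matching n} (i : Fin (2 * n))
    (h0 : (tableauSeq π i).1 = (tableauSeq π' i).1)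
    (h1 : (tableauSeq π (i + 1)).1 = (tableauSeq π' (i + 1)).1)
    (h2 : (tableauSeq π (i + 1)).box = (tableauSeq π' (i + 1)).box) :
    (tableauSeq π i).box = (tableauSeq π' i).box ∧ (i < π.1 i → π.1 i = π'.1 i) := by
  have hiff : i < π.1 i ↔ i < π'.1 i := by
    rw [open_iff_addsBox, open_iff_addsBox, h0, h1]
  have hs : ∀ r c, (tableauSeq π i).box r c = ⊤ ↔ (tableauSeq π' i).box r c = ⊤ := fun r c => by
    rw [← not_iff_not]
    change _ ≠ ⊤ ↔ _ ≠ ⊤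
    rw [← Tableau.mem_iff_box, ← Tableau.mem_iff_box, h0]
  by_cases h : i < π.1 i
  · rw [tableauSeq_open π i h, tableauSeq_open π' i (hiff.1 h)] at h2
    have h3 := insertFilling_injective (Tableau.isFilling_box _) (Tableau.isFilling_box _) h2 hs
    exact ⟨h3.1, fun _ => Fin.ext (by have := h3.2; omega)⟩
  · have h3 : π.1 i < i := lt_of_le_of_ne (not_lt.1 h) (π.2.2 i)
    have h4 : π'.1 i < i := lt_of_le_of_ne (not_lt.1 (mt hiff.2 h)) (π'.2.2 i)
    rw [tableauSeq_close π i h3, tableauSeq_close π' i h4] at h2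
    refine ⟨slideFilling_injective (Tableau.isFilling_box _) (Tableau.isFilling_box _) h2 hs ?_ ?_,
      fun h5 => absurd h5 h⟩
    · rw [tableauSeq_corner π i h3, tableauSeq_corner π' i h4]
    · rw [tableauSeq_corner π i h3]
      simp

/-- Go backwards from the empty final tableau: the shapes tell which kind of step to undo, and
undoing it is unambiguous. The undone insertions reveal the partners of all opening letters, hence
the whole matching. -/
theorem shapeSeq_injective {n : ℕ} {π π' : Matching n} (h : shapeSeq π = shapeSeq π') :
    π = π' := by
  have h0 : ∀ a ≤ 2 * n, (tableauSeq π a).1 = (tableauSeq π' a).1 := fun a ha =>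
    congrFun h ⟨a, by omega⟩
  have hbox : ∀ a ≤ 2 * n, (tableauSeq π a).box = (tableauSeq π' a).box := by
    intro a ha
    induction ha using Nat.decreasingInduction with
    | self => rw [tableauSeq_last, tableauSeq_last]
    | of_succ a ha ih =>
      exact (tableauSeq_step_injective ⟨a, ha⟩ (h0 a (by omega)) (h0 (a + 1) ha) ih).1
  have hopen : ∀ i : Fin (2 * n), i < π.1 i → π.1 i = π'.1 i := fun i =>
    (tableauSeq_step_injective i (h0 i i.2.le) (h0 (i + 1) i.2) (hbox (i + 1) i.2)).2
  refine Subtype.ext (Equiv.ext fun i => ?_)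
  by_cases hi : i < π.1 i
  · exact hopen i hi
  · have h1 : π.1 i < π.1 (π.1 i) := by
      rw [π.apply_apply]
      exact lt_of_le_of_ne (not_lt.1 hi) (π.2.2 i)
    have h2 := hopen _ h1
    rw [π.apply_apply] at h2
    exact (π'.apply_apply _).symm.trans (congrArg π'.1 h2.symm)

/-! ### Surjectivity -/

/-- An opening position `a` is joined to position `x a - 1`, since letters are positions plus one.
The hypotheses make this a bijection from opening to closing positions. -/
theorem exists_matching_of_pairs {n : ℕ} (U : ℕ → Prop) (x : ℕ → ℕ)
    (h1 : ∀ a < 2 * n, U a → ∃ d, x a = d + 1 ∧ a < d ∧ d < 2 * n ∧ ¬ U d)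
    (h2 : ∀ a < 2 * n, ∀ b < 2 * n, U a → U b → x a = x b → a = b)
    (h3 : ∀ d < 2 * n, ¬ U d → ∃ a, a < d ∧ U a ∧ x a = d + 1) :
    ∃ π : Matching n, ∀ i : Fin (2 * n),
      (U i → i < π.1 i ∧ (π.1 i).val + 1 = x i) ∧ (¬ U i → π.1 i < i) := by
  have hex : ∀ i : Fin (2 * n), ∃ j : Fin (2 * n),
      (U i ∧ ¬ U j ∧ i < j ∧ x i = j.val + 1) ∨ (¬ U i ∧ U j ∧ j < i ∧ x j = i.val + 1) := by
    intro i
    by_cases hi : U i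
    · obtain ⟨d, hd1, hd2, hd3, hd4⟩ := h1 i i.2 hi
      exact ⟨⟨d, hd3⟩, Or.inl ⟨hi, hd4, hd2, hd1⟩⟩
    · obtain ⟨a, ha1, ha2, ha3⟩ := h3 i i.2 hi
      exact ⟨⟨a, ha1.trans i.2⟩, Or.inr ⟨hi, ha2, ha1, ha3⟩⟩
  choose f hf using hex
  have hinv : Function.Involutive f := by
    intro i
    rcases hf i with ⟨a1, a2, a3, a4⟩ | ⟨a1, a2, a3, a4⟩ <;>
      rcases hf (f i) with ⟨b1, b2, b3, b4⟩ | ⟨b1, b2, b3, b4⟩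
    · exact absurd b1 a2
    · exact Fin.ext (h2 _ (f (f i)).2 _ i.2 b2 a1 (by rw [b4, a4]))
    · exact Fin.ext (by omega)
    · exact absurd a2 b1
  refine ⟨⟨hinv.toPerm, ?_, fun i hi => ?_⟩, fun i => ⟨fun hi => ?_, fun hi => ?_⟩⟩
  · ext i
    simp [pow_two, hinv i]
  · have hi : f i = i := hi
    rcases hf i with ⟨-, -, a3, -⟩ | ⟨-, -, a3, -⟩ <;> exact a3.ne (by simp [hi])
  · rcases hf i with ⟨-, -, a3, a4⟩ | ⟨a1, -, -, -⟩
    · exact ⟨a3, a4.symm⟩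
    · exact absurd hi a1
  · rcases hf i with ⟨a1, -, -, -⟩ | ⟨-, -, a3, -⟩
    · exact absurd a1 hi
    · exact a3

/-- `F` is a filling of `μ` with distinct letters from `{a + 1, …, m}`. -/
structure IsPartialTableau (m a : ℕ) (μ : YoungDiagram) (F : ℕ → ℕ → WithTop ℕ) : Prop where
  filling : IsFilling F
  distinct : EntriesDistinct F
  shape : ∀ r c, F r c ≠ ⊤ ↔ (r, c) ∈ μ
  entries : ∀ v, HasEntry F v → a < v ∧ v ≤ m

theorem IsPartialTableau.exists_insert {m a : ℕ} {μ ν : YoungDiagram} {G : ℕ → ℕ → WithTop ℕ}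
    (hG : IsPartialTableau m (a + 1) ν G) (h : AddsBox μ ν) :
    ∃ F x, IsPartialTableau m a μ F ∧ G = insertFilling F x ∧ ¬ HasEntry F x := by
  obtain ⟨r₀, c₀, h1, h2⟩ := addsBox_iff.1 h
  have htop : ∀ r c, r₀ ≤ r → c₀ ≤ c → ¬ (r = r₀ ∧ c = c₀) → G r c = ⊤ := by
    intro r c h3 h4 h5
    by_contra h6
    exact h1 (μ.up_left_mem h3 h4 (((h2 r c).1 ((hG.shape r c).1 h6)).resolve_right h5))
  obtain ⟨F, x, hF, hins, hs⟩ := exists_insertFilling_eq hG.filling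
    ((hG.shape r₀ c₀).2 ((h2 r₀ c₀).2 (Or.inr ⟨rfl, rfl⟩)))
    (htop r₀ (c₀ + 1) le_rfl (Nat.le_succ _) (by omega))
    (htop (r₀ + 1) c₀ (Nat.le_succ _) le_rfl (by omega))
  obtain ⟨hd, hx⟩ := EntriesDistinct.of_insert (hins ▸ hG.distinct)
  refine ⟨F, x, ⟨hF, hd, fun r c => ?_, fun v hv => ?_⟩, hins.symm, hx⟩
  · rw [Ne, hs, not_or, ← Ne, hG.shape, h2]
    by_cases h3 : r = r₀ ∧ c = c₀
    · simp [h3, h1]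
    · simp [h3]
  · have := hG.entries v (hins ▸ hasEntry_insertFilling.2 (Or.inr hv))
    omega

theorem IsPartialTableau.exists_slide {m a : ℕ} {μ ν : YoungDiagram} {G : ℕ → ℕ → WithTop ℕ}
    (hG : IsPartialTableau m (a + 1) ν G) (h : AddsBox ν μ) (ha : a < m) :
    ∃ F, IsPartialTableau m a μ F ∧ F 0 0 = ((a + 1 : ℕ) : WithTop ℕ) ∧
      G = slideFilling F (0, 0) := by
  obtain ⟨r₀, c₀, h1, h2⟩ := addsBox_iff.1 h
  have hmem := (h2 r₀ c₀).2 (Or.inr ⟨rfl, rfl⟩)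
  have hne : ∀ r c, r ≤ r₀ → c ≤ c₀ → ¬ (r = r₀ ∧ c = c₀) → G r c ≠ ⊤ := by
    intro r c h3 h4 h5
    exact (hG.shape r c).2 (((h2 r c).1 (μ.up_left_mem h3 h4 hmem)).resolve_right h5)
  have hi : ∀ r c, ((a + 1 : ℕ) : WithTop ℕ) < G r c := by
    intro r c
    by_cases h3 : G r c = ⊤
    · simp [h3]
    · obtain ⟨v, hv⟩ := exists_natCast_eq h3
      rw [← hv]
      exact_mod_cast (hG.entries v ⟨r, c, hv.symm⟩).1
  obtain ⟨F, hF, h0, hsl, hs⟩ := exists_slideFilling_eq hG.filling hG.distinct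
    (by
      by_contra h3
      exact h1 ((hG.shape r₀ c₀).1 h3))
    (fun c hc => hne r₀ c le_rfl (by omega) (by omega))
    (fun r hr => hne r c₀ (by omega) le_rfl (by omega)) hi
  have hd : EntriesDistinct F :=
    EntriesDistinct.of_slide (hsl ▸ hG.distinct) (by rw [hsl, h0]; exact hi)
  refine ⟨F, ⟨hF, hd, fun r c => ?_, fun v hv => ?_⟩, h0, hsl.symm⟩
  · rw [Ne, hs, h2, ← hG.shape, not_and_or, not_not]
  · by_cases h3 : F 0 0 = v
    · rw [h0] at h3
      have : a + 1 = v := by exact_mod_cast h3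
      omega
    · have := hG.entries v (hsl ▸ (hasEntry_slideFilling hd).2 ⟨hv, h3⟩)
      omega

theorem exists_partialTableaux {m : ℕ} (lam : ℕ → YoungDiagram) (hlast : lam m = ⊥)
    (hstep : ∀ a < m, AddsBox (lam a) (lam (a + 1)) ∨ AddsBox (lam (a + 1)) (lam a)) :
    ∃ (F : ℕ → ℕ → ℕ → WithTop ℕ) (x : ℕ → ℕ), ∀ a ≤ m, IsPartialTableau m a (lam a) (F a) ∧
      (a < m → (AddsBox (lam a) (lam (a + 1)) ∧ F (a + 1) = insertFilling (F a) (x a) ∧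
        ¬ HasEntry (F a) (x a)) ∨
      (¬ AddsBox (lam a) (lam (a + 1)) ∧ F a 0 0 = ((a + 1 : ℕ) : WithTop ℕ) ∧
        F (a + 1) = slideFilling (F a) (0, 0))) := by
  suffices hsuf : ∀ b ≤ m, ∃ (F : ℕ → ℕ → ℕ → WithTop ℕ) (x : ℕ → ℕ), ∀ a, b ≤ a → a ≤ m →
      IsPartialTableau m a (lam a) (F a) ∧
      (a < m → (AddsBox (lam a) (lam (a + 1)) ∧ F (a + 1) = insertFilling (F a) (x a) ∧
        ¬ HasEntry (F a) (x a)) ∨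
      (¬ AddsBox (lam a) (lam (a + 1)) ∧ F a 0 0 = ((a + 1 : ℕ) : WithTop ℕ) ∧
        F (a + 1) = slideFilling (F a) (0, 0))) by
    obtain ⟨F, x, h⟩ := hsuf 0 (Nat.zero_le _)
    exact ⟨F, x, fun a => h a (Nat.zero_le _)⟩
  intro b hb
  induction hb using Nat.decreasingInduction with
  | self =>
    refine ⟨fun _ _ _ => ⊤, fun _ => 0, fun a h1 h2 => ?_⟩
    obtain rfl : m = a := le_antisymm h1 h2
    refine ⟨⟨⟨fun _ _ => le_rfl, fun _ _ h => absurd rfl h, by simp⟩,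
      fun _ _ _ _ _ h => absurd rfl h, fun r c => ?_, fun v hv => ?_⟩, fun h => by omega⟩
    · rw [hlast]
      simp [YoungDiagram.notMem_bot]
    · obtain ⟨_, _, h⟩ := hv
      simp at h
  | of_succ b hb ih =>
    obtain ⟨F, x, h⟩ := ih
    obtain ⟨G, y, hG⟩ : ∃ G y, IsPartialTableau m b (lam b) G ∧
        ((AddsBox (lam b) (lam (b + 1)) ∧ F (b + 1) = insertFilling G y ∧ ¬ HasEntry G y) ∨
        (¬ AddsBox (lam b) (lam (b + 1)) ∧ G 0 0 = ((b + 1 : ℕ) : WithTop ℕ) ∧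
        F (b + 1) = slideFilling G (0, 0))) := by
      have h1 := (h (b + 1) le_rfl hb).1
      rcases hstep b hb with h2 | h2
      · obtain ⟨G, y, h3, h4⟩ := h1.exists_insert h2
        exact ⟨G, y, h3, Or.inl ⟨h2, h4⟩⟩
      · obtain ⟨G, h3, h4⟩ := h1.exists_slide h2 hb
        -- A closing step inserts nothing, so the recorded letter is arbitrary.
        exact ⟨G, 0, h3, Or.inr ⟨h2.not_symm, h4⟩⟩
    refine ⟨Function.update F b G, Function.update x b y, fun a h1 h2 => ?_⟩
    rcases h1.lt_or_eq with h3 | rfl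
    · rw [Function.update_of_ne h3.ne', Function.update_of_ne (by omega),
        Function.update_of_ne h3.ne']
      exact h a h3 h2
    · rw [Function.update_self, Function.update_of_ne (by omega), Function.update_self]
      exact ⟨hG.1, fun _ => hG.2⟩

/-- In the tableaux built backwards, each inserted letter survives until the step that removes it,
and every removed letter was inserted earlier. Pairing insertions with removals gives the matching,
and the forward construction reproduces these tableaux. -/
theorem exists_matching_of_diagrams {n : ℕ} (lam : ℕ → YoungDiagram) (hfirst : lam 0 = ⊥)
    (hlast : lam (2 * n) = ⊥)
    (hstep : ∀ a < 2 * n, AddsBox (lam a) (lam (a + 1)) ∨ AddsBox (lam (a + 1)) (lam a)) :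
    ∃ π : Matching n, ∀ a ≤ 2 * n, (tableauSeq π a).1 = lam a := by
  obtain ⟨F, x, h⟩ := exists_partialTableaux lam hlast hstep
  set U : ℕ → Prop := fun a => AddsBox (lam a) (lam (a + 1)) with hU
  have hup : ∀ a < 2 * n, U a → F (a + 1) = insertFilling (F a) (x a) ∧
      ¬ HasEntry (F a) (x a) := by
    intro a ha hu
    rcases (h a ha.le).2 ha with h1 | h1
    · exact h1.2
    · exact absurd hu h1.1
  have hdown : ∀ a < 2 * n, ¬ U a → F a 0 0 = ((a + 1 : ℕ) : WithTop ℕ) ∧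
      F (a + 1) = slideFilling (F a) (0, 0) := by
    intro a ha hu
    rcases (h a ha.le).2 ha with h1 | h1
    · exact absurd h1.1 hu
    · exact h1.2
  have hsucc : ∀ a < 2 * n, ∀ v, HasEntry (F a) v → a + 1 < v → HasEntry (F (a + 1)) v := by
    intro a ha v hv hlt
    by_cases hu : U a
    · rw [(hup a ha hu).1]
      exact hasEntry_insertFilling.2 (Or.inr hv)
    · rw [(hdown a ha hu).2]
      refine (hasEntry_slideFilling (h a ha.le).1.distinct).2 ⟨hv, fun h1 => ?_⟩
      rw [(hdown a ha hu).1] at h1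
      have : a + 1 = v := by exact_mod_cast h1
      omega
  have hpersist : ∀ a b v, a ≤ b → b < v → v ≤ 2 * n → HasEntry (F a) v → HasEntry (F b) v := by
    intro a b v hab hbv hv h1
    induction b, hab using Nat.le_induction with
    | base => exact h1
    | succ b hab ih => exact hsucc b (by omega) v (ih (by omega)) hbv
  have hins : ∀ a < 2 * n, U a → HasEntry (F (a + 1)) (x a) := by
    intro a ha hu
    rw [(hup a ha hu).1]
    exact hasEntry_insertFilling.2 (Or.inl rfl)
  have hbd : ∀ a < 2 * n, U a → a + 1 < x a ∧ x a ≤ 2 * n := fun a ha hu =>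
    (h (a + 1) ha).1.entries _ (hins a ha hu)
  obtain ⟨π, hπ⟩ : ∃ π : Matching n, ∀ i : Fin (2 * n),
      (U i → i < π.1 i ∧ (π.1 i).val + 1 = x i) ∧ (¬ U i → π.1 i < i) := by
    refine exists_matching_of_pairs U x (fun a ha hu => ?_) (fun a ha b hb hua hub hab => ?_)
      fun d hd hu => ?_
    · have h1 := hbd a ha hu
      obtain ⟨d, hd⟩ : ∃ d, x a = d + 1 := ⟨x a - 1, by omega⟩
      refine ⟨d, hd, by omega, by omega, fun hud => ?_⟩
      -- Were step `d` opening, the letter `d + 1` would survive into `F (d + 1)`, whose letters all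
      -- exceed `d + 1`.
      have h2 := hpersist (a + 1) d (x a) (by omega) (by omega) h1.2 (hins a ha hu)
      have h3 := (h (d + 1) (by omega)).1.entries (x a)
        ((hup d (by omega) hud).1 ▸ hasEntry_insertFilling.2 (Or.inr h2))
      omega
    · have key : ∀ a b, a < 2 * n → b < 2 * n → U a → U b → x a = x b → ¬ a < b := by
        intro a b ha hb hua hub hab hlt
        have h1 := hbd b hb hub
        refine (hup b hb hub).2 ?_
        rw [← hab]
        exact hpersist (a + 1) b _ hlt (by omega) (by omega) (hins a ha hua)
      have h1 := key a b ha hb hua hub hab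
      have h2 := key b a hb ha hub hua hab.symm
      omega
    · have h1 : HasEntry (F d) (d + 1) := ⟨0, 0, (hdown d hd hu).1⟩
      have h0 : ¬ HasEntry (F 0) (d + 1) := by
        rintro ⟨r, c, h2⟩
        have h3 := ((h 0 (Nat.zero_le _)).1.shape r c).1 (by simp [h2])
        rw [hfirst] at h3
        exact YoungDiagram.notMem_bot _ h3
      by_contra hcon
      push Not at hcon
      -- The initial tableau is empty, so without an insertion of `d + 1` this letter could never be
      -- present to be removed at step `d`.
      have h2 : ∀ a ≤ d, ¬ HasEntry (F a) (d + 1) := by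
        intro a
        induction a with
        | zero => exact fun _ => h0
        | succ a ih =>
          intro ha h3
          by_cases hua : U a
          · rw [(hup a (by omega) hua).1, hasEntry_insertFilling] at h3
            rcases h3 with h3 | h3
            · exact hcon a (by omega) hua h3.symm
            · exact ih (by omega) h3
          · rw [(hdown a (by omega) hua).2,
              hasEntry_slideFilling (h a (by omega)).1.distinct] at h3
            exact ih (by omega) h3.1
      exact h2 d le_rfl h1
  have hbox : ∀ a ≤ 2 * n, (tableauSeq π a).box = F a := by
    intro a
    induction a with
    | zero =>
      intro _
      rw [tableauSeq, Tableau.box_empty]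
      funext r c
      by_contra h1
      have h2 := ((h 0 (Nat.zero_le _)).1.shape r c).1 (Ne.symm h1)
      rw [hfirst] at h2
      exact YoungDiagram.notMem_bot _ h2
    | succ a ih =>
      intro ha
      have h1 := hπ ⟨a, ha⟩
      have h2 := ih (by omega)
      by_cases hu : U a
      · rw [tableauSeq_open π ⟨a, ha⟩ (h1.1 hu).1, (h1.1 hu).2, (hup a ha hu).1, h2]
      · rw [tableauSeq_close π ⟨a, ha⟩ (h1.2 hu), (hdown a ha hu).2, h2]
  refine ⟨π, fun a ha => diagram_ext fun r c => ?_⟩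
  rw [Tableau.mem_iff_box, hbox a ha, (h a ha).1.shape]

/-- The bijection `T`. -/
noncomputable def shapeTableau {n : ℕ} (π : Matching n) : OscillatingTableau (2 * n) ⊥ where
  diagram := shapeSeq π
  first := rfl
  last := diagram_ext fun r c => by
    rw [shapeSeq, Tableau.mem_iff_box, Fin.val_last, tableauSeq_last]
    simp [YoungDiagram.notMem_bot]
  step i := by
    rcases lt_or_gt_of_ne (π.2.2 i) with h | h
    · exact Or.inr (addsBox_of_close π i h)
    · exact Or.inl (addsBox_of_open π i h)

theorem shapeTableau_bijective (n : ℕ) :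
    Function.Bijective (shapeTableau : Matching n → OscillatingTableau (2 * n) ⊥) := by
  refine ⟨fun π π' h => shapeSeq_injective (congrArg OscillatingTableau.diagram h), fun t => ?_⟩
  obtain ⟨π, hπ⟩ := exists_matching_of_diagrams (n := n)
    (fun a => if h : a < 2 * n + 1 then t.diagram ⟨a, h⟩ else ⊥) (by simpa using t.first)
    (by rw [dif_pos (Nat.lt_succ_self _)]; exact t.last) (fun a ha => by
      simp only [dif_pos (by omega : a < 2 * n + 1), dif_pos (by omega : a + 1 < 2 * n + 1)]
      exact t.step ⟨a, ha⟩)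
  refine ⟨π, OscillatingTableau.ext (funext fun i => ?_)⟩
  have h1 := hπ i (Nat.lt_succ_iff.1 i.2)
  rw [dif_pos i.2] at h1
  exact h1

/-! ### Descents in terms of diagrams -/

/-- The added box lies in the last row reached by the insertion, so the two halves of the row
bumping lemma compare the rows of the two boxes. -/
theorem descent_iff_of_open_open {n : ℕ} (π : Matching n) {i j : Fin (2 * n)}
    (hij : j.val = i.val + 1) (hi : i < π.1 i) (hj : j < π.1 j) :
    π.1 j < π.1 i ↔
      DescentChain (tableauSeq π i).1 (tableauSeq π j).1 (tableauSeq π (j + 1)).1 := by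
  obtain ⟨R, k, h1, h2, h3⟩ := tableauSeq_open_box π i hi
  obtain ⟨R', k', h1', h2', h3'⟩ := tableauSeq_open_box π j hj
  have hbox := tableauSeq_open π i hi
  rw [← hij] at h3 hbox
  rw [descentChain_iff h2 h3 h2' h3']
  rw [hbox] at h1'
  have hF := Tableau.isFilling_box (tableauSeq π i)
  constructor
  · intro h
    have h4 := carried_insert_succ_ne_top hF
      (by omega : (π.1 j).val + 1 < (π.1 i).val + 1) R ((h1 R).2 le_rfl)
    exact (h1' (R + 1)).1 h4
  · intro h
    by_contra h4
    have h5 := carried_le_carried_insert hF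
      (by omega : (π.1 i).val + 1 ≤ (π.1 j).val + 1) R'
    have h6 := (h1 R').1 (ne_top_of_le_ne_top ((h1' R').2 le_rfl) h5)
    omega

/-- The larger of the two letters is already present when the smaller one enters through row 0. From
then on every step preserves the relative position. -/
theorem strictlyBelow_of_lt {n : ℕ} (π : Matching n) {i j : Fin (2 * n)}
    (hij : j.val = i.val + 1) (hi : π.1 i < i) (hlt : π.1 j < π.1 i) :
    StrictlyBelow (tableauSeq π i).box (i.val + 1) (i.val + 1 + 1) := by
  suffices h : ∀ b, (π.1 i).val + 1 ≤ b → b ≤ i.val →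
      StrictlyBelow (tableauSeq π b).box (i.val + 1) (i.val + 1 + 1) from h _ hi le_rfl
  intro b hb
  induction b, hb using Nat.le_induction with
  | base =>
    intro _
    have h1 : π.1 i < π.1 (π.1 i) := by rwa [π.apply_apply]
    rw [tableauSeq_open π _ h1, π.apply_apply]
    refine strictlyBelow_insert (Tableau.isFilling_box _) ?_
    refine ((tableauSeq_entries π (π.1 i) (π.1 i).2.le).2 _).2 ⟨j, by omega, by omega, hlt⟩
  | succ b hb ih =>
    intro hbi
    have h1 := ih (by omega)
    set m : Fin (2 * n) := ⟨b, by omega⟩ with hm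
    rcases lt_or_gt_of_ne (π.2.2 m) with h2 | h2
    · rw [tableauSeq_close π m h2]
      refine h1.slide (Tableau.isFilling_box _) (tableauSeq_entries π m m.2.le).1 ?_
      rw [tableauSeq_corner π m h2]
      intro h3
      have : b + 1 = i.val + 1 := by exact_mod_cast h3
      omega
    · rw [tableauSeq_open π m h2]
      exact h1.insert (Tableau.isFilling_box _)

/-- Here the larger letter enters last, into row 0, hence weakly above the smaller one. -/
theorem weaklyAbove_of_lt {n : ℕ} (π : Matching n) {i j : Fin (2 * n)}
    (hij : j.val = i.val + 1) (hj : π.1 j < i) (hlt : π.1 i < π.1 j) :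
    WeaklyAbove (tableauSeq π i).box (i.val + 1) (i.val + 1 + 1) := by
  suffices h : ∀ b, (π.1 j).val + 1 ≤ b → b ≤ i.val →
      WeaklyAbove (tableauSeq π b).box (i.val + 1) (i.val + 1 + 1) from h _ hj le_rfl
  intro b hb
  induction b, hb using Nat.le_induction with
  | base =>
    intro _
    have h1 : π.1 j < π.1 (π.1 j) := by
      rw [π.apply_apply, Fin.lt_def]
      omega
    rw [tableauSeq_open π _ h1, π.apply_apply, hij]
    refine weaklyAbove_insert ?_
    exact ((tableauSeq_entries π (π.1 j) (π.1 j).2.le).2 _).2 ⟨i, rfl, le_of_lt hj, hlt⟩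
  | succ b hb ih =>
    intro hbi
    have h1 := ih (by omega)
    set m : Fin (2 * n) := ⟨b, by omega⟩ with hm
    have hd := (tableauSeq_entries π m m.2.le).1
    rcases lt_or_gt_of_ne (π.2.2 m) with h2 | h2
    · rw [tableauSeq_close π m h2]
      refine h1.slide (Tableau.isFilling_box _) hd ?_
      rw [tableauSeq_corner π m h2]
      exact_mod_cast (by omega : b + 1 < i.val + 1)
    · rw [tableauSeq_open π m h2]
      -- The letter of `i` was inserted at position `π.1 i`, before the present range, so it is not
      -- the letter inserted now.
      refine h1.insert (Tableau.isFilling_box _) hd fun h3 => ?_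
      have h4 : π.1 m = i := Fin.ext (by omega)
      have h5 : m = π.1 i := by rw [← h4, π.apply_apply]
      have h6 : b = (π.1 i).val := congrArg Fin.val h5
      omega

/-- The insertion order of the two letters fixes the first hole's initial direction, hence the side
on which the second hole runs, hence the order of the rows of the removed boxes. -/
theorem descent_iff_of_close_close {n : ℕ} (π : Matching n) {i j : Fin (2 * n)}
    (hij : j.val = i.val + 1) (hi : π.1 i < i) (hj : π.1 j < j) :
    π.1 j < π.1 i ↔
      DescentChain (tableauSeq π (j + 1)).1 (tableauSeq π j).1 (tableauSeq π i).1 := by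
  obtain ⟨R, C, g1, g2, g3, g4, g5⟩ := tableauSeq_close_box π i hi
  obtain ⟨R', C', g1', g2', g3', g4', g5'⟩ := tableauSeq_close_box π j hj
  have hbox := tableauSeq_close π i hi
  rw [← hij] at g4 g5 hbox
  rw [descentChain_iff g4' g5' g4 g5]
  have hF := Tableau.isFilling_box (tableauSeq π i)
  have hd := (tableauSeq_entries π i i.2.le).1
  have h0 := tableauSeq_corner π i hi
  have hmem : (R', C') ∈ (tableauSeq π j).1 := (g5' R' C').2 (Or.inr ⟨rfl, rfl⟩)
  rw [hbox] at g1'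
  have hji : (π.1 j).val ≠ i.val := fun h => by
    have h1 : π.1 j = i := Fin.ext h
    have h2 : j = π.1 i := by rw [← h1, π.apply_apply]
    rw [← h2] at hi
    omega
  constructor
  · intro h
    have h1 := (strictlyBelow_of_lt π hij hi h).next_le hF h0 hd
    refine second_lastBox_lt hF h1 g1 g2 g3 g1'
      (Tableau.mem_iff_box.1 ((g5 R' C').2 (Or.inl hmem))) ?_
    rintro ⟨rfl, rfl⟩
    exact g4 hmem
  · intro h
    by_contra h1
    have hne : π.1 i ≠ π.1 j := fun h => by
      have := congrArg Fin.val (π.1.injective h)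
      omega
    have h2 := (weaklyAbove_of_lt π hij (lt_of_le_of_ne (by omega) fun h => hji (congrArg _ h))
      (lt_of_le_of_ne (not_lt.1 h1) hne)).next_lt hF h0 hd
    have h3 : R ≤ R' := by
      refine second_lastBox_ge hF h2 g1
        (Tableau.mem_iff_box.1 ((g5 R C).2 (Or.inr ⟨rfl, rfl⟩))) g1' ?_
      by_contra h4
      rw [not_or] at h4
      have h5 := ((g5 (R' + 1) C').1 (Tableau.mem_iff_box.2 h4.1)).resolve_right h4.2
      exact Tableau.mem_iff_box.1 h5 g2'
    omega

/-! ### Conjugation -/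

theorem transpose_addsBox_iff {μ ν : YoungDiagram} :
    AddsBox μ.transpose ν.transpose ↔ AddsBox μ ν :=
  ⟨fun h => by simpa using h.transpose, AddsBox.transpose⟩

/-- The indicator function of the opening letters. -/
noncomputable def openIndicator {n : ℕ} (π : Matching n) (i : Fin (2 * n)) : ℤ :=
  if i < π.1 i then 1 else 0

theorem open_iff_of_conj {n : ℕ} {π π' : Matching n}
    (h : ∀ a ≤ 2 * n, (tableauSeq π' a).1 = (tableauSeq π a).1.transpose) (i : Fin (2 * n)) :
    i < π'.1 i ↔ i < π.1 i := by
  rw [open_iff_addsBox, open_iff_addsBox, h i i.2.le, h (i + 1) i.2, transpose_addsBox_iff]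

theorem descent_add_descent {n : ℕ} {π π' : Matching n}
    (h : ∀ a ≤ 2 * n, (tableauSeq π' a).1 = (tableauSeq π a).1.transpose) {i j : Fin (2 * n)}
    (hij : j.val = i.val + 1) :
    (if π.1 j < π.1 i then 1 else 0 : ℤ) + (if π'.1 j < π'.1 i then 1 else 0) =
      1 + openIndicator π i - openIndicator π j := by
  have hi := h i i.2.le
  have hj := h j j.2.le
  have hj1 := h (j + 1) j.2
  unfold openIndicator
  by_cases h1 : i < π.1 i <;> by_cases h2 : j < π.1 j
  · have h1' := (open_iff_of_conj h i).2 h1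
    have h2' := (open_iff_of_conj h j).2 h2
    rw [if_pos h1, if_pos h2]
    have e1 := addsBox_of_open π i h1
    rw [← hij] at e1
    have e2 : π'.1 j < π'.1 i ↔ ¬ π.1 j < π.1 i := by
      rw [descent_iff_of_open_open π hij h1 h2, descent_iff_of_open_open π' hij h1' h2', hi, hj,
        hj1, descentChain_transpose e1 (addsBox_of_open π j h2)]
    by_cases h3 : π.1 j < π.1 i <;> simp [e2, h3]
  · have h1' := (open_iff_of_conj h i).2 h1
    have h2' := mt (open_iff_of_conj h j).1 h2
    have n1 := π.val_ne j
    have n2 := π'.val_ne j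
    -- Opening then closing: `π j ≤ i < π i`, and likewise for `π'`, so both have a descent.
    rw [if_pos h1, if_neg h2, if_pos (by omega), if_pos (by omega)]
    rfl
  · have h1' := mt (open_iff_of_conj h i).1 h1
    have h2' := (open_iff_of_conj h j).2 h2
    -- Closing then opening: `π i < i < j < π j`, and likewise for `π'`, so neither has a descent.
    rw [if_neg h1, if_pos h2, if_neg (by omega), if_neg (by omega)]
    rfl
  · have h1' := mt (open_iff_of_conj h i).1 h1
    have h2' := mt (open_iff_of_conj h j).1 h2
    rw [if_neg h1, if_neg h2]
    have c1 := lt_of_le_of_ne (not_lt.1 h1) (π.2.2 i)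
    have c2 := lt_of_le_of_ne (not_lt.1 h2) (π.2.2 j)
    have c1' := lt_of_le_of_ne (not_lt.1 h1') (π'.2.2 i)
    have c2' := lt_of_le_of_ne (not_lt.1 h2') (π'.2.2 j)
    have e1 := addsBox_of_close π i c1
    rw [← hij] at e1
    have e2 : π'.1 j < π'.1 i ↔ ¬ π.1 j < π.1 i := by
      rw [descent_iff_of_close_close π hij c1 c2, descent_iff_of_close_close π' hij c1' c2', hi,
        hj, hj1, descentChain_transpose (addsBox_of_close π j c2) e1]
    by_cases h3 : π.1 j < π.1 i <;> simp [e2, h3]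

/-- Each block contains exactly one opening letter, so the indicator and its pullback along `π` add
up to 1 everywhere. -/
theorem sum_openIndicator {n : ℕ} (π : Matching n) : ∑ i, openIndicator π i = n := by
  have h1 : ∀ i, openIndicator π i + openIndicator π (π.1 i) = 1 := by
    intro i
    unfold openIndicator
    rw [π.apply_apply]
    rcases lt_or_gt_of_ne (π.2.2 i) with h | h
    · rw [if_neg h.not_gt, if_pos h]
      rfl
    · rw [if_pos h, if_neg h.not_gt]
      rfl
  have h2 := Finset.sum_congr (rfl : Finset.univ = Finset.univ) fun i _ => h1 i
  rw [Finset.sum_add_distrib, Equiv.sum_comp π.1 (openIndicator π)] at h2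
  simp only [Finset.sum_const, Finset.card_univ, Fintype.card_fin, nsmul_eq_mul, mul_one] at h2
  push_cast at h2
  omega

/-! ### Sums over descents -/

theorem sum_descentSet {m : ℕ} (σ : Equiv.Perm (Fin (m + 1))) (f : ℕ → ℤ) :
    ∑ i ∈ descentSet σ, f i =
      ∑ i : Fin m, (if σ i.succ < σ i.castSucc then 1 else 0) * f (i.val + 1) := by
  rw [descentSet, Finset.sum_image (fun a _ b _ h => Fin.ext (Nat.succ_injective h)),
    Finset.sum_filter, Fin.sum_univ_castSucc, if_neg (by simp), add_zero]
  refine Finset.sum_congr rfl fun i _ => ?_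
  have h : (∃ h : i.castSucc.val + 1 < m + 1, σ ⟨i.castSucc.val + 1, h⟩ < σ i.castSucc) ↔
      σ i.succ < σ i.castSucc :=
    ⟨fun ⟨_, h⟩ => h, fun h => ⟨Nat.succ_lt_succ i.2, h⟩⟩
  rw [ite_mul, one_mul, zero_mul]
  exact if_congr h rfl rfl

/-- Abel summation, doubled so that the triangular number needs no division. -/
theorem sum_mul_sub_succ {m : ℕ} (f : Fin (m + 1) → ℤ) :
    ∑ i : Fin m, (1 + f i.castSucc - f i.succ) * ((i.val : ℤ) + 1) * 2 =
      m * (m + 1) + 2 * ∑ i, f i - 2 * (m + 1) * f (Fin.last m) := by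
  induction m with
  | zero => simp
  | succ m ih =>
    have h := ih fun i => f i.castSucc
    rw [Fin.sum_univ_castSucc, Fin.sum_univ_castSucc (f := f)]
    simp only [Fin.val_castSucc, Fin.val_last, Fin.succ_castSucc, Fin.succ_last] at h ⊢
    rw [h]
    push_cast
    ring

theorem sum_sub_succ {m : ℕ} (f : Fin (m + 1) → ℤ) :
    ∑ i : Fin m, (1 + f i.castSucc - f i.succ) = m + f 0 - f (Fin.last m) := by
  induction m with
  | zero => simp
  | succ m ih =>
    have h := ih fun i => f i.castSucc
    rw [Fin.sum_univ_castSucc]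
    simp only [Fin.succ_castSucc, Fin.succ_last, Fin.castSucc_zero] at h ⊢
    rw [h]
    push_cast
    ring

theorem descents_of_conj {n : ℕ} {π π' : Matching n}
    (h : ∀ a ≤ 2 * n, (tableauSeq π' a).1 = (tableauSeq π a).1.transpose) :
    descentNumber π.1 + descentNumber π'.1 = 2 * (n + 1) ∧
      majorIndex π.1 + majorIndex π'.1 = 2 * n ^ 2 := by
  -- For `n = 0` there is no first or last letter at which to evaluate the indicator, so this case
  -- is separate.
  rcases n with _ | k
  · have h0 : ∀ π : Matching 0, descentSet π.1 = ∅ := fun π => by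
      rw [descentSet, Finset.image_eq_empty]
      exact Finset.eq_empty_of_isEmpty (α := Fin 0) _
    simp [descentNumber, majorIndex, h0]
  · let f : Fin (2 * k + 1 + 1) → ℤ := openIndicator π
    have hstep : ∀ i : Fin (2 * k + 1),
        (if π.1 i.succ < π.1 i.castSucc then 1 else 0 : ℤ) +
          (if π'.1 i.succ < π'.1 i.castSucc then 1 else 0) =
        1 + f i.castSucc - f i.succ := fun i =>
      descent_add_descent h (i := i.castSucc) (j := i.succ) rfl
    have hfirst : f 0 = 1 :=
      if_pos (lt_of_le_of_ne (Fin.zero_le _) (π.2.2 (0 : Fin (2 * k + 1 + 1))).symm)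
    have hlast : f (Fin.last _) = 0 := if_neg (Fin.le_last _).not_gt
    have hsum : ∑ i, f i = ((k + 1 : ℕ) : ℤ) := sum_openIndicator π
    have key : ∀ g : ℕ → ℤ, ∑ i ∈ descentSet π.1, g i + ∑ i ∈ descentSet π'.1, g i =
        ∑ i : Fin (2 * k + 1), (1 + f i.castSucc - f i.succ) * g (i.val + 1) := by
      intro g
      have e1 := sum_descentSet (m := 2 * k + 1) π.1 g
      have e2 := sum_descentSet (m := 2 * k + 1) π'.1 g
      rw [e1, e2, ← Finset.sum_add_distrib]
      refine Finset.sum_congr rfl fun i _ => ?_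
      rw [← add_mul, hstep]
    constructor
    · have h1 := key fun _ => 1
      simp only [mul_one, sum_sub_succ, hfirst, hlast, Finset.sum_const, nsmul_eq_mul] at h1
      unfold descentNumber
      push_cast at h1
      omega
    · have h1 := key fun i => i
      have h2 := sum_mul_sub_succ f
      rw [← Finset.sum_mul, hsum, hlast] at h2
      push_cast at h1 h2
      rw [← h1] at h2
      unfold majorIndex
      zify
      linarith

/-! ### The involution -/

theorem OscillatingTableau.conjEmpty_conjEmpty {m : ℕ} (t : OscillatingTableau m ⊥) :
    t.conjEmpty.conjEmpty = t :=
  OscillatingTableau.ext (funext fun i => YoungDiagram.transpose_transpose (t.diagram i))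

/-- Conjugation of oscillating tableaux of empty shape, as a permutation. -/
def conjEquiv (m : ℕ) : OscillatingTableau m ⊥ ≃ OscillatingTableau m ⊥ where
  toFun := OscillatingTableau.conjEmpty
  invFun := OscillatingTableau.conjEmpty
  left_inv := OscillatingTableau.conjEmpty_conjEmpty
  right_inv := OscillatingTableau.conjEmpty_conjEmpty

theorem natCard_eq_of_add_eq {α : Type*} (e : α ≃ α) (f : α → ℕ) {s a b : ℕ}
    (h : ∀ x, f x + f (e x) = s) (hab : a + b = s) :
    Nat.card {x // f x = a} = Nat.card {x // f x = b} :=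
  Nat.card_congr (e.subtypeEquiv fun x => by
    have := h x
    omega)

end Sundaram

theorem mainTheorem2 (n : ℕ) :
    (∃ T : Sundaram.Matching n ≃ Sundaram.OscillatingTableau (2 * n) ⊥,
      (∀ π : Sundaram.Matching n, (T π).diagram = Sundaram.shapeSeq π) ∧
      ∀ π π' : Sundaram.Matching n, π' = T.symm (T π).conjEmpty →
        Sundaram.descentNumber π.1 + Sundaram.descentNumber π'.1 = 2 * (n + 1) ∧
        Sundaram.majorIndex π.1 + Sundaram.majorIndex π'.1 = 2 * n ^ 2) ∧
    (∀ a b : ℕ, a + b = 2 * (n + 1) →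
      Nat.card {π : Sundaram.Matching n // Sundaram.descentNumber π.1 = a} =
        Nat.card {π : Sundaram.Matching n // Sundaram.descentNumber π.1 = b}) ∧
    (∀ a b : ℕ, a + b = 2 * n ^ 2 →
      Nat.card {π : Sundaram.Matching n // Sundaram.majorIndex π.1 = a} =
        Nat.card {π : Sundaram.Matching n // Sundaram.majorIndex π.1 = b}) := by
  let T := Equiv.ofBijective _ (Sundaram.shapeTableau_bijective n)
  have hT : ∀ π π' : Sundaram.Matching n, π' = T.symm (T π).conjEmpty →
      Sundaram.descentNumber π.1 + Sundaram.descentNumber π'.1 = 2 * (n + 1) ∧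
        Sundaram.majorIndex π.1 + Sundaram.majorIndex π'.1 = 2 * n ^ 2 := by
    intro π π' h
    refine Sundaram.descents_of_conj fun a ha => ?_
    have h1 : T π' = (T π).conjEmpty := by rw [h, Equiv.apply_symm_apply]
    exact congrFun (congrArg Sundaram.OscillatingTableau.diagram h1) ⟨a, Nat.lt_succ_of_le ha⟩
  -- The map `π ↦ π'` is a permutation of the matchings that replaces each statistic by its
  -- complement to the constant sum, which gives the symmetry.
  let e : Sundaram.Matching n ≃ Sundaram.Matching n :=
    (T.trans (Sundaram.conjEquiv (2 * n))).trans T.symm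
  exact ⟨⟨T, fun _ => rfl, hT⟩,
    fun a b hab => Sundaram.natCard_eq_of_add_eq e (fun π => Sundaram.descentNumber π.1)
      (fun π => (hT π _ rfl).1) hab,
    fun a b hab => Sundaram.natCard_eq_of_add_eq e (fun π => Sundaram.majorIndex π.1)
      (fun π => (hT π _ rfl).2) hab⟩
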